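/- Let $n\ge 1$, $s\in(0,1]$, $\beta\in(0,1)$ and $\alpha\in(0,\min\{1,2s\})$ with $2s\beta+\alpha<2$. Write $\overline{x}=(x,t)\in\mathbb{R}^n\times\mathbb{R}=\mathbb{R}^{n+1}$ and, for $\overline{y}=(y,\tau)$, $|\overline{x}-\overline{y}|_{p_s}:=\max\{|x-y|,|t-\tau|^{1/(2s)}\}$. Let $B(\overline{x},r)$ be the $s$-parabolic ball, i.e. the product of the Euclidean ball of centre $x$ and radius $r$ and the interval of centre $t$ and length $(2r)^{2s}$. A positive Borel measure $\mu$ on $\mathbb{R}^{n+1}$ has upper $s$-parabolic growth of degree $\rho$ with constant $A\geq 0$ if $\mu(B(\overline{x},r))\le A\,r^{\rho}$ for all $\overline{x}\in\mathbb{R}^{n+1}$, $r>0$. For $f:\mathbb{R}^{n+1}\to\mathbb{R}$ put $$\|f\|_{\mathrm{Lip}_\alpha,p_s}:=\sup_{\overline{x}\ne\overline{y}}\frac{|f(\overline{x})-f(\overline{y})|}{|\overline{x}-\overline{y}|_{p_s}^{\alpha}},\qquad \partial_t^{\beta}f(x,t):=\int_{\mathbb{R}}\frac{f(x,\tau)-f(x,t)}{|\tau-t|^{1+\beta}}\,d\tau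 .$$ Let $P_s(x,t)$ be, for $t>0$, the inverse Fourier transform in the spatial variable of $\xi\mapsto e^{-4\pi^2t|\xi|^{2s}}$ (with the convention $\int e^{2\pi i\langle x,\xi\rangle}(\cdot)\,d\xi$), and $P_s(x,t)=0$ for $t\le 0$. Then there is a constant $C>0$ depending only on $n,s,\beta,\alpha$ such that, for every $A\ge 0$ and every positive Borel measure $\mu$ on $\mathbb{R}^{n+1}$ with upper $s$-parabolic growth of degree $n+2s\beta+\alpha$ with constant $A$: 1. if the convolution $\partial_t^{\beta}P_s\ast\mu$ of the kernel $\partial_t^\beta P_s$ with $\mu$ converges absolutely at every point, then $$\|\partial_t^{\beta}P_s\ast\mu\|_{\mathrm{Lip}_\alpha,p_s}\le C\,A;$$ 2. if $\mu$ is finite, then this convolution does converge absolutely at every point, so that the estimate in 1 holds; moreover $P_s\ast\mu$ converges absolutely at every point, the integral defining $\partial_t^{\beta}(P_s\ast\mu)$ converges absolutely at every point, and $\partial_t^{\beta}(P_s\ast\mu)=(\partial_t^{\beta}P_s)\ast\mu$ everywhere. (Where the integral defining $\partial_t^\beta P_s$ does not converge, the kernel is given the value $0$; such points do not affect the convolutions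 above.) -/

import Mathlib

open MeasureTheory
open scoped ENNReal FourierTransform

noncomputable section

/-- Points `(x, t)` of `ℝⁿ⁺¹ = ℝⁿ × ℝ`, with the Euclidean norm on the spatial factor. -/
abbrev SpaceTime (n : ℕ) : Type := EuclideanSpace ℝ (Fin n) × ℝ

namespace FracCaloric

variable {n : ℕ}

/-- The `s`-parabolic distance `max {|x - y|, |t - τ| ^ (1 / (2 s))}`. -/
def pdist (s : ℝ) (p q : SpaceTime n) : ℝ :=
  max ‖p.1 - q.1‖ (|p.2 - q.2| ^ (1 / (2 * s)))

/-- The `s`-parabolic ball of centre `p` and radius `r`: the product of the Euclidean ball of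
radius `r` and the concentric time interval of length `(2 r) ^ (2 s)`. -/
def pball (s : ℝ) (p : SpaceTime n) (r : ℝ) : Set (SpaceTime n) :=
  {q | ‖q.1 - p.1‖ < r ∧ |q.2 - p.2| < (2 * r) ^ (2 * s) / 2}

/-- Upper `s`-parabolic growth of degree `ρ` with constant `A`. -/
def HasGrowth (s ρ A : ℝ) (μ : Measure (SpaceTime n)) : Prop :=
  ∀ (p : SpaceTime n) (r : ℝ), 0 < r → μ (pball s p r) ≤ ENNReal.ofReal (A * r ^ ρ)

/-- The `s`-parabolic `Lip_α` seminorm, with values in `[0, ∞]`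
(the terms with `p = q` contribute `0`). -/
def lipSeminorm (s α : ℝ) (f : SpaceTime n → ℝ) : ℝ≥0∞ :=
  ⨆ (p : SpaceTime n) (q : SpaceTime n), ENNReal.ofReal (|f p - f q| / pdist s p q ^ α)

/-- The kernel `P_s`: for `t > 0` the inverse spatial Fourier transform
(with kernel `exp (2 π i ⟨x, ξ⟩)`) of `ξ ↦ exp (-4 π² t |ξ| ^ (2 s))`, which is real-valued
because this function is even, and `0` for `t ≤ 0`. -/
def P (s : ℝ) (p : SpaceTime n) : ℝ :=
  if 0 < p.2 then
    (𝓕⁻ (fun ξ : EuclideanSpace ℝ (Fin n) =>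
      ((Real.exp (-4 * Real.pi ^ 2 * p.2 * ‖ξ‖ ^ (2 * s)) : ℝ) : ℂ)) p.1).re
  else 0

/-- The integrand `(f (x, τ) - f (x, t)) / |τ - t| ^ (1 + β)` of the `β`-temporal derivative. -/
def timeQuotient (β : ℝ) (f : SpaceTime n → ℝ) (p : SpaceTime n) (τ : ℝ) : ℝ :=
  (f (p.1, τ) - f p) / |τ - p.2| ^ (1 + β)

/-- The `β`-temporal derivative `∂_t^β f`. -/
def timeDeriv (β : ℝ) (f : SpaceTime n → ℝ) (p : SpaceTime n) : ℝ :=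
  ∫ τ : ℝ, timeQuotient β f p τ

/-- The convolution `k ∗ μ` converges absolutely at every point. -/
def ConvConverges (k : SpaceTime n → ℝ) (μ : Measure (SpaceTime n)) : Prop :=
  ∀ p : SpaceTime n, Integrable (fun q => k (p - q)) μ

/-- The convolution `k ∗ μ` of a kernel with a measure. -/
def conv (k : SpaceTime n → ℝ) (μ : Measure (SpaceTime n)) (p : SpaceTime n) : ℝ :=
  ∫ q, k (p - q) ∂μ

end FracCaloric

end

/-! The kernel `P s` is self-similar under the parabolic dilations `(x, t) ↦ (z x, z ^ (2 s) t)`. A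
smooth dyadic partition of unity in time writes it as a sum over `z = 2 ^ k` of `piece s z`, each a
rescaling of one function `slab s` living in `1 ≤ t ≤ 8`. On that slab the kernel, its time
derivatives and their spatial increments of size at most one decay like `(1 + |x|) ^ (-(n + s))`.
This is weaker than the true rate `n + 2 s` but integrable in `x`, which is all that is needed. The
decay comes from a dyadic decomposition in frequency, where the only obstacle is the non-smoothness
of `|ξ| ^ (2 s)` at the origin (`decaysLip_symbol`).

The fractional quotient of the slab, integrated in absolute value over the time increment, is then
bounded by `weight s β`, that is by `(1 + |x|) ^ (-(n + s)) (1 + |t|) ^ (-(1 + β))`; its increments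
carry an additional factor of the displacement (`exists_slab_bound`). Averaging the weight over unit
balls shows that its integral against a measure is controlled by the masses of unit balls
(`exists_lintegral_weight_le`). At scale `z` the kernel contributes `z ^ (-(n + 2 s β))` and the
growth condition `A z ^ (n + 2 s β + α)`. Hence a piece has total contribution at most `C A z ^ α`,
and for points at distance `r ≤ z` its increment is at most `C A z ^ α (r / z + (r / z) ^ (2 s))`
(`exists_potential_bounds`).

Summing the first bound over `z < r` and the second over `z ≥ r` gives two geometric series because
`0 < α < min 1 (2 s)`, both of size `A r ^ α`; this is the Lipschitz estimate. For a finite measure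
the large scales are also bounded by `z ^ (-(n + 2 s β)) μ(univ)`, so all dyadic series converge
absolutely. Fubini's theorem then exchanges the fractional derivative with the convolution. -/

noncomputable section

set_option linter.unusedSectionVars false

namespace FracCaloric

open Module Set
open scoped ContDiff

/-! ### Fourier decay from dyadic pieces in frequency. -/

section Frequency

variable {V : Type*} [NormedAddCommGroup V] [InnerProductSpace ℝ V] [FiniteDimensional ℝ V]
  [MeasurableSpace V] [BorelSpace V]

/-- `b` is smooth, vanishes outside the ball of radius `2`, and its derivatives of order at most
`dim V + 1` are bounded by `a`. -/
structure IsPiece (b : V → ℂ) (a : ℝ) : Prop where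
  smooth : ContDiff ℝ ∞ b
  eq_zero : ∀ v, 2 < ‖v‖ → b v = 0
  bound : ∀ i ≤ finrank ℝ V + 1, ∀ v, ‖iteratedFDeriv ℝ i b v‖ ≤ a

variable {b : V → ℂ} {a : ℝ}

lemma IsPiece.nonneg (h : IsPiece b a) : 0 ≤ a :=
  (norm_nonneg _).trans (h.bound 0 (by simp) 0)

lemma IsPiece.support_subset (h : IsPiece b a) : tsupport b ⊆ Metric.closedBall 0 2 := by
  refine closure_minimal (fun v hv => ?_) Metric.isClosed_closedBall
  by_contra hv'
  exact hv (h.eq_zero v (by simpa using hv'))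

lemma IsPiece.iteratedFDeriv_eq_zero (h : IsPiece b a) (i : ℕ) {v : V} (hv : 2 < ‖v‖) :
    iteratedFDeriv ℝ i b v = 0 := by
  by_contra h'
  have := h.support_subset (support_iteratedFDeriv_subset i h')
  simp at this
  linarith

lemma IsPiece.hasCompactSupport (h : IsPiece b a) : HasCompactSupport b :=
  (isCompact_closedBall (0 : V) 2).of_isClosed_subset isClosed_closure h.support_subset

lemma IsPiece.integrable_iteratedFDeriv (h : IsPiece b a) (k i : ℕ) :
    Integrable fun v => ‖v‖ ^ k * ‖iteratedFDeriv ℝ i b v‖ := by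
  refine Continuous.integrable_of_hasCompactSupport ?_ ?_
  · have := h.smooth.continuous_iteratedFDeriv (m := i) (by exact_mod_cast le_top)
    fun_prop
  · exact (h.hasCompactSupport.iteratedFDeriv (𝕜 := ℝ) i).norm.mul_left

lemma IsPiece.integral_iteratedFDeriv_le (h : IsPiece b a) {k i : ℕ} (hk : k ≤ 1)
    (hi : i ≤ finrank ℝ V + 1) :
    ∫ v, ‖v‖ ^ k * ‖iteratedFDeriv ℝ i b v‖ ≤
      2 * a * (volume : Measure V).real (Metric.closedBall 0 2) := by
  have hfin : (volume : Measure V) (Metric.closedBall 0 2) ≠ ⊤ :=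
    (isCompact_closedBall (0 : V) 2).measure_ne_top
  have key : ∫ v in Metric.closedBall (0 : V) 2, ‖v‖ ^ k * ‖iteratedFDeriv ℝ i b v‖ =
      ∫ v, ‖v‖ ^ k * ‖iteratedFDeriv ℝ i b v‖ := by
    refine setIntegral_eq_integral_of_forall_compl_eq_zero fun v hv => ?_
    rw [h.iteratedFDeriv_eq_zero i (by simpa using hv)]
    simp
  rw [← key]
  refine (Real.le_norm_self _).trans (norm_setIntegral_le_of_norm_le_const (hfin.lt_top) ?_)
  intro v hv
  have hv : ‖v‖ ≤ 2 := by simpa using hv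
  rw [norm_mul, norm_pow, norm_norm, norm_norm]
  have : ‖v‖ ^ k ≤ 2 := by
    interval_cases k
    · simp
    · simpa using hv
  exact mul_le_mul this (h.bound i hi v) (norm_nonneg _) (by norm_num)

lemma IsPiece.integrable (h : IsPiece b a) : Integrable b :=
  h.smooth.continuous.integrable_of_hasCompactSupport h.hasCompactSupport

lemma IsPiece.integral_norm_le (h : IsPiece b a) :
    ∫ v, ‖b v‖ ≤ 2 * a * (volume : Measure V).real (Metric.closedBall 0 2) := by
  have := h.integral_iteratedFDeriv_le (k := 0) (i := 0) (by norm_num) (by positivity)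
  simpa using this

/-- The Fourier transform of a piece and its derivative decay to the order `dim V + 1`. -/
lemma exists_piece_decay : ∃ C : ℝ, 0 < C ∧ ∀ (b : V → ℂ) (a : ℝ), IsPiece b a → ∀ y : V,
    Differentiable ℝ (𝓕 b) ∧
    ‖𝓕 b y‖ ≤ C * a * (1 + ‖y‖) ^ (-((finrank ℝ V : ℝ) + 1)) ∧
    ‖fderiv ℝ (𝓕 b) y‖ ≤ C * a * (1 + ‖y‖) ^ (-((finrank ℝ V : ℝ) + 1)) := by
  set d := finrank ℝ V
  set B := (volume : Measure V).real (Metric.closedBall 0 2)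
  have hB : 0 ≤ B := measureReal_nonneg
  -- a uniform bound for the weighted derivatives of order at most one
  set C₀ : ℝ := (2 * Real.pi) * 4 ^ (d + 1) * (2 * (d + 2) * (2 * B)) with hC₀
  have hpi : (1 : ℝ) ≤ 2 * Real.pi := by linarith [Real.pi_gt_three]
  have hC₀nn : 0 ≤ C₀ := by positivity
  have main : ∀ (b : V → ℂ) (a : ℝ), IsPiece b a → ∀ k ≤ 1, ∀ n ≤ d + 1, ∀ y : V,
      ‖y‖ ^ n * ‖iteratedFDeriv ℝ k (𝓕 b) y‖ ≤ C₀ * a := by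
    intro b a h k hk n hn y
    have ha := h.nonneg
    refine (Real.pow_mul_norm_iteratedFDeriv_fourier_le (K := ⊤) (N := ⊤) h.smooth
      (fun k n _ _ => h.integrable_iteratedFDeriv k n) le_top le_top y).trans ?_
    have hsum : ∑ p ∈ Finset.range (k + 1) ×ˢ Finset.range (n + 1),
        ∫ v, ‖v‖ ^ p.1 * ‖iteratedFDeriv ℝ p.2 b v‖ ≤ (2 * (d + 2)) * (2 * a * B) := by
      refine (Finset.sum_le_card_nsmul _ _ (2 * a * B) ?_).trans ?_
      · intro p hp
        simp only [Finset.mem_product, Finset.mem_range] at hp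
        exact h.integral_iteratedFDeriv_le (by omega) (by omega)
      · rw [nsmul_eq_mul]
        refine mul_le_mul_of_nonneg_right ?_ (by positivity)
        simp only [Finset.card_product, Finset.card_range]
        have : (k + 1) * (n + 1) ≤ 2 * (d + 2) := Nat.mul_le_mul (by omega) (by omega)
        exact_mod_cast this
    have h1 : (2 * Real.pi) ^ k ≤ 2 * Real.pi := by
      simpa using pow_le_pow_right₀ hpi hk
    have h2 : (2 * (k : ℝ) + 2) ^ n ≤ 4 ^ (d + 1) := by
      have hk' : (k : ℝ) ≤ 1 := by exact_mod_cast hk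
      calc (2 * (k : ℝ) + 2) ^ n ≤ 4 ^ n := by gcongr; linarith
        _ ≤ 4 ^ (d + 1) := pow_le_pow_right₀ (by norm_num) hn
    calc _ ≤ (2 * Real.pi) * 4 ^ (d + 1) * ((2 * (d + 2)) * (2 * a * B)) := by gcongr
      _ = C₀ * a := by rw [hC₀]; ring
  -- The weights of order `0` and `d + 1` are combined through `(1 + ‖y‖) ^ (d + 1) ≤ 2 ^ d (1 + ‖y‖
  -- ^ (d + 1))`; the summand `1` only keeps the constant positive.
  refine ⟨2 ^ (d + 1) * C₀ + 1, by positivity, fun b a h y => ?_⟩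
  have ha := h.nonneg
  have conv : ∀ X : ℝ, 0 ≤ X → X ≤ C₀ * a → ‖y‖ ^ (d + 1) * X ≤ C₀ * a →
      X ≤ (2 ^ (d + 1) * C₀ + 1) * a * (1 + ‖y‖) ^ (-((d : ℝ) + 1)) := by
    intro X hX h0 h1
    have hy : 0 < 1 + ‖y‖ := by positivity
    rw [Real.rpow_neg hy.le, ← div_eq_mul_inv, le_div_iff₀ (by positivity)]
    have e : (1 + ‖y‖) ^ ((d : ℝ) + 1) = (1 + ‖y‖) ^ (d + 1) := by
      rw [← Real.rpow_natCast]; push_cast; rfl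
    rw [e]
    have := add_pow_le zero_le_one (norm_nonneg y) (d + 1)
    simp only [one_pow, Nat.add_sub_cancel] at this
    calc X * (1 + ‖y‖) ^ (d + 1) ≤ X * (2 ^ d * (1 + ‖y‖ ^ (d + 1))) := by gcongr
      _ = 2 ^ d * (X + ‖y‖ ^ (d + 1) * X) := by ring
      _ ≤ 2 ^ d * (C₀ * a + C₀ * a) := by gcongr
      _ = 2 ^ (d + 1) * C₀ * a := by ring
      _ ≤ _ := by nlinarith
  refine ⟨?_, ?_, ?_⟩
  · have : ContDiff ℝ ((1 : ℕ∞) : WithTop ℕ∞) (𝓕 b) := Real.contDiff_fourier fun n _ => by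
      simpa using h.integrable_iteratedFDeriv n 0
    exact this.differentiable (by simp)
  · have h0 := main b a h 0 (by norm_num) 0 (by simp) y
    have h1 := main b a h 0 (by norm_num) (d + 1) le_rfl y
    simp only [norm_iteratedFDeriv_zero, pow_zero, one_mul] at h0 h1
    exact conv _ (norm_nonneg _) h0 h1
  · have h0 := main b a h 1 le_rfl 0 (by simp) y
    have h1 := main b a h 1 le_rfl (d + 1) le_rfl y
    simp only [norm_iteratedFDeriv_one, pow_zero, one_mul] at h0 h1
    exact conv _ (norm_nonneg _) h0 h1

/-- The weight which controls a dilate by the factor `z`. -/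
def dyadicWeight (d : ℕ) (σ z : ℝ) : ℝ := z ^ σ + z ^ (-((d : ℝ) + 1))

/-- If `z ≥ 1`, then `1 + y / z ≥ (1 + y) / z` and the decay costs `z ^ (d + σ)`, of which `z ^
(-d)` absorbs all but `z ^ σ`. If `z ≤ 1`, then `1 + y / z ≥ 1 + y` and the prefactor is at most `z
^ (-(d + 1))`. The exponent `e = d` serves the transform of a dilate and `e = d + 1` its gradient.
-/
lemma rescaled_decay_le (d : ℕ) {σ z y : ℝ} (hσ : 0 ≤ σ) (hσ1 : σ ≤ 1) (hz : 0 < z) (hy : 0 ≤ y)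
    {e : ℝ} (he : (d : ℝ) ≤ e) (he1 : e ≤ d + 1) :
    z ^ (-e) * (1 + y / z) ^ (-((d : ℝ) + 1)) ≤ dyadicWeight d σ z * (1 + y) ^ (-((d : ℝ) + σ)) := by
  have hy1 : 1 ≤ 1 + y := by linarith
  have hyz : 1 ≤ 1 + y / z := by have : 0 ≤ y / z := by positivity
                                 linarith
  rcases le_total 1 z with h | h
  · have h1 : (1 + y) / z ≤ 1 + y / z := by
      rw [add_div]; gcongr; exact (div_le_one hz).2 h
    calc z ^ (-e) * (1 + y / z) ^ (-((d : ℝ) + 1))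
        ≤ z ^ (-(d : ℝ)) * ((1 + y) / z) ^ (-((d : ℝ) + σ)) := by
          gcongr ?_ * ?_
          · exact Real.rpow_le_rpow_of_exponent_le h (by linarith)
          · calc (1 + y / z) ^ (-((d : ℝ) + 1)) ≤ (1 + y / z) ^ (-((d : ℝ) + σ)) :=
                Real.rpow_le_rpow_of_exponent_le hyz (by linarith)
              _ ≤ _ := Real.rpow_le_rpow_of_nonpos (by positivity) h1 (by
                have : (0:ℝ) ≤ d := by positivity
                linarith)
      _ = z ^ σ * (1 + y) ^ (-((d : ℝ) + σ)) := by
          rw [Real.div_rpow (by positivity) hz.le, mul_div_assoc', mul_comm (z ^ _), mul_div_assoc,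
            ← Real.rpow_sub hz, mul_comm]
          congr 2; ring
      _ ≤ _ := by
          unfold dyadicWeight
          gcongr
          have : 0 < z ^ (-((d : ℝ) + 1)) := by positivity
          linarith
  · have h1 : 1 + y ≤ 1 + y / z := by
      gcongr; rw [le_div_iff₀ hz]; nlinarith
    have hd : (0 : ℝ) ≤ d := by positivity
    calc z ^ (-e) * (1 + y / z) ^ (-((d : ℝ) + 1))
        ≤ z ^ (-((d : ℝ) + 1)) * (1 + y) ^ (-((d : ℝ) + σ)) := by
          gcongr ?_ * ?_
          · exact Real.rpow_le_rpow_of_exponent_ge hz h (by linarith)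
          · calc (1 + y / z) ^ (-((d : ℝ) + 1)) ≤ (1 + y) ^ (-((d : ℝ) + 1)) :=
                Real.rpow_le_rpow_of_nonpos (by positivity) h1 (by linarith)
              _ ≤ _ := Real.rpow_le_rpow_of_exponent_le hy1 (by linarith)
      _ ≤ _ := by
          unfold dyadicWeight
          gcongr
          have : 0 < z ^ σ := by positivity
          linarith

/-- `f` decays to the order `r`, and so do its increments of size at most one. -/
def DecaysLip (r : ℝ) (f : V → ℂ) : Prop :=
  ∃ C : ℝ, 0 < C ∧ (∀ x, ‖f x‖ ≤ C * (1 + ‖x‖) ^ (-r)) ∧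
    ∀ x y, ‖x - y‖ ≤ 1 → ‖f x - f y‖ ≤ C * ‖x - y‖ * (1 + ‖x‖) ^ (-r)

lemma fourier_comp_smul (b : V → ℂ) {z : ℝ} (hz : 0 < z) (x : V) :
    𝓕 (fun v => b (z • v)) x = ((z ^ (-(finrank ℝ V : ℝ)) : ℝ) : ℂ) * 𝓕 b (z⁻¹ • x) := by
  rw [Real.fourier_eq', Real.fourier_eq']
  have := Measure.integral_comp_smul (volume : Measure V)
    (fun v => Complex.exp (↑(-2 * Real.pi * inner ℝ v (z⁻¹ • x)) * Complex.I) • b v) z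
  rw [abs_of_nonneg (by positivity)] at this
  rw [Real.rpow_neg hz.le, Real.rpow_natCast, ← Complex.real_smul, ← this]
  congr 1
  ext v
  rw [inner_smul_left, inner_smul_right]
  congr 4
  simp
  field_simp

/-- **Dyadic criterion.** -/
theorem decaysLip_of_hasSum_pieces [Nontrivial V] {σ : ℝ} (hσ : 0 ≤ σ) (hσ1 : σ ≤ 1) {b : ℤ → V → ℂ} {a : ℤ → ℝ}
    (hb : ∀ k, IsPiece (b k) (a k))
    (ha : Summable fun k => a k * dyadicWeight (finrank ℝ V) σ ((2 : ℝ) ^ k))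
    {m : V → ℂ} (hm : ∀ ξ, ξ ≠ 0 → HasSum (fun k => b k ((2 : ℝ) ^ k • ξ)) (m ξ)) :
    DecaysLip (finrank ℝ V + σ) (𝓕 m) := by
  set d := finrank ℝ V
  obtain ⟨C, hC, hdec⟩ := exists_piece_decay (V := V)
  set S := ∑' k, a k * dyadicWeight d σ ((2 : ℝ) ^ k)
  have hz : ∀ k : ℤ, (0 : ℝ) < 2 ^ k := fun k => by positivity
  have hW : ∀ k : ℤ, 0 ≤ dyadicWeight d σ ((2 : ℝ) ^ k) := fun k => by
    unfold dyadicWeight; positivity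
  have hS : 0 ≤ S := tsum_nonneg fun k => mul_nonneg (hb k).nonneg (hW k)
  -- termwise bounds
  have t0 : ∀ k x, ‖𝓕 (fun v => b k ((2 : ℝ) ^ k • v)) x‖ ≤
      C * (1 + ‖x‖) ^ (-(d + σ)) * (a k * dyadicWeight d σ ((2 : ℝ) ^ k)) := by
    intro k x
    rw [fourier_comp_smul _ (hz k), norm_mul, Complex.norm_real, Real.norm_of_nonneg (by positivity)]
    have h1 := (hdec _ _ (hb k) (((2 : ℝ) ^ k)⁻¹ • x)).2.1
    rw [norm_smul, norm_inv, Real.norm_of_nonneg (hz k).le, inv_mul_eq_div] at h1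
    have h2 := rescaled_decay_le d hσ hσ1 (hz k) (norm_nonneg x) le_rfl (by linarith)
    calc _ ≤ ((2 : ℝ) ^ k) ^ (-(d : ℝ)) * (C * a k * (1 + ‖x‖ / 2 ^ k) ^ (-((d : ℝ) + 1))) := by
          gcongr
      _ = C * a k * (((2 : ℝ) ^ k) ^ (-(d : ℝ)) * (1 + ‖x‖ / 2 ^ k) ^ (-((d : ℝ) + 1))) := by ring
      _ ≤ C * a k * (dyadicWeight d σ (2 ^ k) * (1 + ‖x‖) ^ (-((d : ℝ) + σ))) := by
          have := (hb k).nonneg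
          gcongr
      _ = _ := by ring
  have t1 : ∀ k x y, ‖x - y‖ ≤ 1 →
      ‖𝓕 (fun v => b k ((2 : ℝ) ^ k • v)) x - 𝓕 (fun v => b k ((2 : ℝ) ^ k • v)) y‖ ≤
      C * (2 ^ ((d : ℝ) + σ) * (1 + ‖x‖) ^ (-(d + σ))) * ‖x - y‖
        * (a k * dyadicWeight d σ ((2 : ℝ) ^ k)) := by
    intro k x y hxy
    set z : ℝ := 2 ^ k
    have hak := (hb k).nonneg
    set B : ℝ := C * a k * (z ^ (d : ℝ) * z *
      (dyadicWeight d σ z * (2 ^ ((d : ℝ) + σ) * (1 + ‖x‖) ^ (-((d : ℝ) + σ)))))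
    -- Mean value inequality: a point `p` of this segment has `z • p` within distance `1` of `x`.
    -- There the decay factor is comparable to the one at `x`, at the cost of `2 ^ (d + σ)`.
    have hseg : ∀ p ∈ segment ℝ (z⁻¹ • y) (z⁻¹ • x), ‖fderiv ℝ (𝓕 (b k)) p‖ ≤ B := by
      intro p hp
      refine ((hdec _ _ (hb k) p).2.2).trans ?_
      have h0 : z • p ∈ Metric.closedBall x 1 := by
        have : z • p ∈ segment ℝ y x := by
          have := mem_image_of_mem (fun v => z • v) hp
          have e := image_segment ℝ (LinearMap.lsmul ℝ V z).toAffineMap (z⁻¹ • y) (z⁻¹ • x)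
          simp only [LinearMap.coe_toAffineMap, LinearMap.lsmul_apply] at e
          change z • p ∈ (LinearMap.lsmul ℝ V z) '' _ at this
          rw [e, smul_inv_smul₀ (hz k).ne', smul_inv_smul₀ (hz k).ne'] at this
          exact this
        refine (convex_closedBall x 1).segment_subset ?_ ?_ this
        · rwa [Metric.mem_closedBall, dist_comm, dist_eq_norm]
        · simp
      have hxp : 1 + ‖x‖ ≤ 2 * (1 + ‖z • p‖) := by
        rw [Metric.mem_closedBall, dist_comm, dist_eq_norm] at h0
        have := norm_sub_norm_le x (z • p)
        have := norm_nonneg (z • p)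
        linarith
      have h2 := rescaled_decay_le d hσ hσ1 (hz k) (norm_nonneg (z • p)) (e := d + 1)
        (by linarith) le_rfl
      have h3 : (1 + ‖z • p‖) ^ (-((d : ℝ) + σ)) ≤
          2 ^ ((d : ℝ) + σ) * (1 + ‖x‖) ^ (-((d : ℝ) + σ)) := by
        have : (2 : ℝ) ^ ((d : ℝ) + σ) * (1 + ‖x‖) ^ (-((d : ℝ) + σ)) =
            ((1 + ‖x‖) / 2) ^ (-((d : ℝ) + σ)) := by
          rw [Real.div_rpow (by positivity) (by norm_num), Real.rpow_neg (by norm_num : (0:ℝ) ≤ 2)]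
          field_simp
        rw [this]
        refine Real.rpow_le_rpow_of_nonpos (by positivity) (by linarith) ?_
        have : (0 : ℝ) ≤ d := by positivity
        linarith
      have e1 : ‖z • p‖ / 2 ^ k = ‖p‖ := by
        rw [norm_smul, Real.norm_of_nonneg (hz k).le]
        field_simp [z]
      rw [e1] at h2
      have e2 : ((2 : ℝ) ^ k) ^ (-((d : ℝ) + 1)) = (z ^ (d : ℝ) * z)⁻¹ := by
        rw [Real.rpow_neg (hz k).le, Real.rpow_add (hz k), Real.rpow_one]
      rw [e2, inv_mul_le_iff₀ (by have := hz k; positivity)] at h2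
      simp only [B]
      gcongr
      refine h2.trans ?_
      gcongr
      exact hW k
    have hdiff : ‖𝓕 (b k) (z⁻¹ • x) - 𝓕 (b k) (z⁻¹ • y)‖ ≤ B * ‖z⁻¹ • x - z⁻¹ • y‖ :=
      Convex.norm_image_sub_le_of_norm_fderiv_le (𝕜 := ℝ)
        (fun p _ => (hdec _ _ (hb k) p).1 p) hseg (convex_segment _ _)
        (left_mem_segment _ _ _) (right_mem_segment _ _ _)
    rw [fourier_comp_smul _ (hz k), fourier_comp_smul _ (hz k), ← mul_sub, norm_mul,
      Complex.norm_real, Real.norm_of_nonneg (by positivity)]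
    rw [← smul_sub, norm_smul, norm_inv, Real.norm_of_nonneg (hz k).le] at hdiff
    calc _ ≤ z ^ (-(d : ℝ)) * (B * (z⁻¹ * ‖x - y‖)) := by gcongr
      _ = (z ^ (-(d : ℝ)) * z ^ (d : ℝ)) * (z * z⁻¹) * (C * (2 ^ ((d : ℝ) + σ) *
          (1 + ‖x‖) ^ (-(d + σ))) * ‖x - y‖ * (a k * dyadicWeight d σ z)) := by
          simp only [B]; ring
      _ = _ := by
          rw [← Real.rpow_add (hz k), mul_inv_cancel₀ (hz k).ne']
          simp
  -- the Fourier transform of the sum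
  have hint : ∀ k, Integrable fun v => b k ((2 : ℝ) ^ k • v) := fun k =>
    (hb k).integrable.comp_smul (hz k).ne'
  -- The bound for the `L¹` norm of the `k`-th dilate is the case `y = 0`, `e = d` of
  -- `rescaled_decay_le`.
  have hnorm : Summable fun k => ∫ v, ‖b k ((2 : ℝ) ^ k • v)‖ := by
    set B := (volume : Measure V).real (Metric.closedBall 0 2)
    refine Summable.of_nonneg_of_le (fun k => integral_nonneg fun v => norm_nonneg _) (fun k => ?_)
      (ha.mul_left (2 * B))
    have e := Measure.integral_comp_smul (volume : Measure V) (fun v => ‖b k v‖) ((2 : ℝ) ^ k)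
    rw [e, abs_of_nonneg (by positivity), smul_eq_mul]
    have h2 := rescaled_decay_le d hσ hσ1 (hz k) le_rfl le_rfl (by linarith)
    simp only [zero_div, add_zero, Real.one_rpow, mul_one] at h2
    rw [Real.rpow_neg (hz k).le, Real.rpow_natCast] at h2
    calc _ ≤ dyadicWeight d σ (2 ^ k) * (2 * a k * B) := by
          gcongr
          · exact hW k
          · exact (hb k).integral_norm_le
      _ = _ := by ring
  have hF : ∀ x, HasSum (fun k => 𝓕 (fun v => b k ((2 : ℝ) ^ k • v)) x) (𝓕 m x) := by
    intro x
    simp only [Real.fourier_eq]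
    have key := hasSum_integral_of_summable_integral_norm
      (F := fun k v => Real.fourierChar (-inner ℝ v x) • b k ((2 : ℝ) ^ k • v))
      (fun k => (Real.fourierIntegral_convergent_iff x).2 (hint k)) (by simpa using hnorm)
    -- The series represents `m` only off the origin, which is a null set because `V` is nontrivial.
    have hV : (volume : Measure V) {0} = 0 := measure_singleton 0
    have e : ∫ v, ∑' k, Real.fourierChar (-inner ℝ v x) • b k ((2 : ℝ) ^ k • v) =
        ∫ v, Real.fourierChar (-inner ℝ v x) • m v := by
      refine integral_congr_ae ?_
      have : ∀ᵐ v : V, v ≠ 0 := compl_mem_ae_iff.2 hV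
      filter_upwards [this] with v hv
      exact ((hm v hv).const_smul _).tsum_eq
    rwa [e] at key
  refine ⟨C * 2 ^ ((d : ℝ) + σ) * (S + 1), by positivity, fun x => ?_, fun x y hxy => ?_⟩
  · rw [← (hF x).tsum_eq]
    refine (tsum_of_norm_bounded (ha.mul_left _).hasSum (fun k => t0 k x)).trans ?_
    rw [tsum_mul_left]
    have h2 : (1 : ℝ) ≤ 2 ^ ((d : ℝ) + σ) := Real.one_le_rpow (by norm_num) (by positivity)
    have hp : 0 ≤ C * (1 + ‖x‖) ^ (-((d : ℝ) + σ)) := by positivity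
    change C * (1 + ‖x‖) ^ (-((d : ℝ) + σ)) * S ≤ _
    calc _ ≤ C * (1 + ‖x‖) ^ (-((d : ℝ) + σ)) * (2 ^ ((d : ℝ) + σ) * (S + 1)) := by
          gcongr; nlinarith
      _ = _ := by ring
  · rw [← (hF x).tsum_eq, ← (hF y).tsum_eq, ← (hF x).summable.tsum_sub (hF y).summable]
    refine (tsum_of_norm_bounded (ha.mul_left _).hasSum (fun k => t1 k x y hxy)).trans ?_
    rw [tsum_mul_left]
    change C * (2 ^ ((d : ℝ) + σ) * (1 + ‖x‖) ^ (-((d : ℝ) + σ))) * ‖x - y‖ * S ≤ _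
    calc _ ≤ C * (2 ^ ((d : ℝ) + σ) * (1 + ‖x‖) ^ (-((d : ℝ) + σ))) * ‖x - y‖ * (S + 1) := by
          gcongr; linarith
      _ = _ := by ring

/-! ### Annular cutoffs and the size of the dyadic pieces. -/

lemma exists_iteratedFDeriv_bound {f : V → ℝ} (hf : ContDiff ℝ ∞ f) (hc : HasCompactSupport f)
    (M : ℕ) : ∃ C : ℝ, 1 ≤ C ∧ ∀ i ≤ M, ∀ v, ‖iteratedFDeriv ℝ i f v‖ ≤ C := by
  have : ∀ i : ℕ, ∃ C, ∀ v, ‖iteratedFDeriv ℝ i f v‖ ≤ C := fun i =>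
    (hf.continuous_iteratedFDeriv (m := i) (by exact_mod_cast le_top)).bounded_above_of_compact_support
      (hc.iteratedFDeriv i)
  choose C hC using this
  have hC0 : ∀ i, 0 ≤ C i := fun i => (norm_nonneg _).trans (hC i 0)
  refine ⟨1 + ∑ i ∈ Finset.range (M + 1), C i,
    by have := Finset.sum_nonneg (fun i (_ : i ∈ Finset.range (M + 1)) => hC0 i); linarith,
    fun i hi v => (hC i v).trans ?_⟩
  have := Finset.single_le_sum (fun i _ => hC0 i) (Finset.mem_range.2 (Nat.lt_succ_of_le hi))
  linarith

/-- Smooth functions supported in the annulus `1/2 ≤ ‖v‖ ≤ 2`. -/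
structure IsAnnular (ϑ : V → ℝ) : Prop where
  smooth : ContDiff ℝ ∞ ϑ
  eq_zero : ∀ v, ¬ (1 / 2 ≤ ‖v‖ ∧ ‖v‖ ≤ 2) → ϑ v = 0

lemma IsAnnular.tsupport_subset {ϑ : V → ℝ} (h : IsAnnular ϑ) :
    tsupport ϑ ⊆ {v | 1 / 2 ≤ ‖v‖ ∧ ‖v‖ ≤ 2} := by
  refine closure_minimal (fun v hv => ?_) ?_
  · by_contra hv'
    exact hv (h.eq_zero v hv')
  · exact (isClosed_le continuous_const continuous_norm).inter
      (isClosed_le continuous_norm continuous_const)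

lemma IsAnnular.hasCompactSupport {ϑ : V → ℝ} (h : IsAnnular ϑ) : HasCompactSupport ϑ :=
  (isCompact_closedBall (0 : V) 2).of_isClosed_subset isClosed_closure
    (h.tsupport_subset.trans fun v hv => by simpa using hv.2)

/-- Leibniz and Faà di Bruno. Derivatives of `g` enter only at values of `Y` on the annulus, hence
on `[1/4, 4]`; elsewhere the product vanishes with all its derivatives. The constant does not depend
on `g`, so whole families of exponentials can be inserted. -/
lemma IsAnnular.exists_comp_bound {ϑ : V → ℝ} (h : IsAnnular ϑ) {Y : V → ℝ} (hY : ContDiff ℝ ∞ Y)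
    (hYc : HasCompactSupport Y)
    (hY4 : ∀ v, 1 / 2 ≤ ‖v‖ → ‖v‖ ≤ 2 → Y v ∈ Icc (1 / 4) 4) (M : ℕ) :
    ∃ C : ℝ, 0 < C ∧ ∀ (g : ℝ → ℝ) (G : ℝ), ContDiff ℝ ∞ g → 0 ≤ G →
      (∀ i ≤ M, ∀ y ∈ Icc (1 / 4 : ℝ) 4, |iteratedDeriv i g y| ≤ G) →
      ∀ i ≤ M, ∀ v, ‖iteratedFDeriv ℝ i (fun v => ϑ v * g (Y v)) v‖ ≤ C * G := by
  obtain ⟨A, hA, hAb⟩ := exists_iteratedFDeriv_bound h.smooth h.hasCompactSupport M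
  obtain ⟨D, hD, hDb⟩ := exists_iteratedFDeriv_bound hY hYc M
  refine ⟨2 ^ M * A * (M.factorial * D ^ M), by positivity, fun g G hg hG hgb i hi v => ?_⟩
  by_cases hv : 1 / 2 ≤ ‖v‖ ∧ ‖v‖ ≤ 2
  · have hcomp : ∀ l ≤ M, ‖iteratedFDeriv ℝ l (g ∘ Y) v‖ ≤ M.factorial * D ^ M * G := by
      intro l hl
      -- The composition estimate asks for the bound `D ^ i` on the `i`-th derivative of `Y`; since
      -- `1 ≤ D`, the uniform bound `D` implies it for `i ≥ 1`.
      have := norm_iteratedFDeriv_comp_le (n := l) (N := ∞) hg hY (by exact_mod_cast le_top) v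
        (C := G) (D := D) (fun i hi => by
          rw [norm_iteratedFDeriv_eq_norm_iteratedDeriv]
          exact hgb i (hi.trans hl) _ (hY4 v hv.1 hv.2))
        (fun i h1 hi => (hDb i (hi.trans hl) v).trans (le_self_pow₀ hD (by omega)))
      refine this.trans ?_
      have h1 : (l.factorial : ℝ) ≤ M.factorial := by exact_mod_cast Nat.factorial_le hl
      have h2 : D ^ l ≤ D ^ M := pow_le_pow_right₀ hD hl
      calc _ ≤ (M.factorial : ℝ) * G * D ^ M := by gcongr
        _ = _ := by ring
    have hmul := norm_iteratedFDeriv_mul_le (N := ∞) h.smooth (hg.comp hY) v (n := i)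
      (by exact_mod_cast le_top)
    refine hmul.trans ?_
    calc _ ≤ ∑ l ∈ Finset.range (i + 1), (i.choose l : ℝ) * A * (M.factorial * D ^ M * G) := by
          refine Finset.sum_le_sum fun l hl => ?_
          have hl : l ≤ i := Nat.lt_succ_iff.1 (Finset.mem_range.1 hl)
          gcongr
          · exact hAb l (hl.trans hi) v
          · exact hcomp (i - l) (by omega)
      _ = 2 ^ i * A * (M.factorial * D ^ M * G) := by
          rw [← Finset.sum_mul, ← Finset.sum_mul]
          congr 2
          exact_mod_cast Nat.sum_range_choose i
      _ ≤ 2 ^ M * A * (M.factorial * D ^ M * G) := by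
          gcongr
          norm_num
      _ = _ := by ring
  · have : iteratedFDeriv ℝ i (fun v => ϑ v * g (Y v)) v = 0 := by
      by_contra h'
      have h1 := support_iteratedFDeriv_subset i h'
      have h2 : tsupport (fun v => ϑ v * g (Y v)) ⊆ tsupport ϑ :=
        closure_mono (Function.support_mul_subset_left _ _)
      exact hv (h.tsupport_subset (h2 h1))
    rw [this, norm_zero]
    positivity

lemma pow_mul_exp_neg_div_four_le (m : ℕ) {x : ℝ} (hx : 0 ≤ x) :
    x ^ m * Real.exp (-(x / 4)) ≤ 4 ^ m * m.factorial := by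
  have := Real.pow_div_factorial_le_exp (x := x / 4) (by positivity) m
  rw [div_le_iff₀ (by positivity), div_pow, div_le_iff₀ (by positivity)] at this
  rw [Real.exp_neg, ← div_eq_mul_inv, div_le_iff₀ (Real.exp_pos _)]
  linarith

/-- Each derivative brings down a factor `l`, but `y ≥ 1 / 4` leaves `exp (-l / 4)`, which beats
every power of `l`. The free exponent `N` provides decay at high frequencies, where `l` is large. -/
lemma iteratedDeriv_exp_neg_bound (M N : ℕ) {l : ℝ} (hl : 0 < l) {i : ℕ} (hi : i ≤ M) {y : ℝ}
    (hy : 1 / 4 ≤ y) :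
    |iteratedDeriv i (fun y => Real.exp (-l * y)) y| ≤
      4 ^ (M + N) * (M + N).factorial * (l ^ N)⁻¹ := by
  rw [iteratedDeriv_exp_const_mul, abs_mul, abs_pow, abs_neg, abs_of_pos hl, Real.abs_exp,
    ← div_eq_mul_inv, le_div_iff₀ (by positivity)]
  have h1 : Real.exp (-l * y) ≤ Real.exp (-(l / 4)) := Real.exp_le_exp.2 (by nlinarith)
  calc l ^ i * Real.exp (-l * y) * l ^ N ≤ l ^ i * Real.exp (-(l / 4)) * l ^ N := by gcongr
    _ = l ^ (i + N) * Real.exp (-(l / 4)) := by rw [pow_add]; ring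
    _ ≤ 4 ^ (i + N) * (i + N).factorial := pow_mul_exp_neg_div_four_le _ hl.le
    _ ≤ 4 ^ (M + N) * (M + N).factorial := by
        have h2 : ((i + N).factorial : ℝ) ≤ (M + N).factorial := by
          exact_mod_cast Nat.factorial_le (by omega)
        gcongr
        norm_num

/-- The low-frequency counterpart: once the constant `1` is removed, a factor `l` comes out of every
derivative, including the one of order zero, where `1 - exp (-l y) ≤ l y ≤ 4 l`. -/
lemma iteratedDeriv_exp_neg_sub_one_bound {B l : ℝ} (hl : 0 < l) (hlB : l ≤ B) (hB : 1 ≤ B) {M : ℕ}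
    {i : ℕ} (hi : i ≤ M) {y : ℝ} (hy : y ∈ Icc (1 / 4 : ℝ) 4) :
    |iteratedDeriv i (fun y => -1 + Real.exp (-l * y)) y| ≤ 4 * B ^ M * l := by
  rcases Nat.eq_zero_or_pos i with rfl | hpos
  · simp only [iteratedDeriv_zero]
    have hy0 : 0 ≤ l * y := by have := hy.1; positivity
    have h1 := Real.add_one_le_exp (-l * y)
    have h2 : Real.exp (-l * y) ≤ 1 := Real.exp_le_one_iff.2 (by linarith)
    have h3 : 1 ≤ B ^ M := one_le_pow₀ hB
    rw [abs_le]
    constructor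
    · nlinarith [hy.2, mul_nonneg hl.le (sub_nonneg.2 h3)]
    · nlinarith [mul_nonneg hl.le (sub_nonneg.2 h3)]
  · rw [iteratedDeriv_const_add hpos, iteratedDeriv_exp_const_mul, abs_mul, abs_pow, abs_neg,
      abs_of_pos hl, Real.abs_exp]
    have h2 : Real.exp (-l * y) ≤ 1 := Real.exp_le_one_iff.2 (by nlinarith [hy.1])
    obtain ⟨j, rfl⟩ : ∃ j, i = j + 1 := ⟨i - 1, by omega⟩
    calc l ^ (j + 1) * Real.exp (-l * y) ≤ l ^ (j + 1) * 1 := by gcongr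
      _ = l ^ j * l := by ring
      _ ≤ B ^ j * l := by gcongr
      _ ≤ B ^ M * l := by gcongr; omega
      _ ≤ _ := by nlinarith [show 0 ≤ B ^ M * l by positivity]

lemma hasSum_int_telescope {f : ℤ → ℝ} {A : ℝ} {K : ℕ} (h0 : ∀ k : ℤ, k ≤ -K → f k = A)
    (h1 : ∀ k : ℤ, (K : ℤ) ≤ k → f k = 0) : HasSum (fun k => f k - f (k + 1)) A := by
  have := hasSum_sum_of_ne_finset_zero (f := fun k => f k - f (k + 1)) (s := Finset.Ico (-K : ℤ) K)
    (L := SummationFilter.unconditional ℤ) (by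
    intro k hk
    rw [Finset.mem_Ico, not_and_or, not_le, not_lt] at hk
    rcases hk with hk | hk
    · rw [h0 k hk.le, h0 (k + 1) (by omega), sub_self]
    · rw [h1 k hk, h1 (k + 1) (by omega), sub_self])
  rwa [Finset.sum_Ico_int_sub, h0 _ le_rfl, h1 _ le_rfl, sub_zero] at this

/-- A smooth cutoff, equal to `1` on the unit ball and supported in the ball of radius `2`. -/
def cutoff (v : V) : ℝ := (⟨1, 2, one_pos, by norm_num⟩ : ContDiffBump (0 : V)) v

lemma cutoff_eq_one {v : V} (hv : ‖v‖ ≤ 1) : cutoff v = 1 :=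
  ContDiffBump.one_of_mem_closedBall _ (by simpa using hv)

lemma cutoff_eq_zero {v : V} (hv : 2 ≤ ‖v‖) : cutoff v = 0 :=
  ContDiffBump.zero_of_le_dist _ (by simpa using hv)

lemma contDiff_cutoff : ContDiff ℝ ∞ (cutoff : V → ℝ) := ContDiffBump.contDiff _

lemma contDiff_cutoff_smul (z : ℝ) : ContDiff ℝ ∞ fun v : V => cutoff (z • v) :=
  contDiff_cutoff.comp (contDiff_const_smul z)

/-- The annular function generating the dyadic partition of unity. -/
def ring1 (v : V) : ℝ := cutoff v - cutoff ((2 : ℝ) • v)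

lemma isAnnular_ring1 : IsAnnular (ring1 : V → ℝ) where
  smooth := contDiff_cutoff.sub (contDiff_cutoff_smul 2)
  eq_zero v hv := by
    rw [not_and_or, not_le, not_le] at hv
    rcases hv with hv | hv
    · rw [ring1, cutoff_eq_one (by linarith), cutoff_eq_one, sub_self]
      rw [norm_smul]; norm_num; linarith
    · rw [ring1, cutoff_eq_zero hv.le, cutoff_eq_zero, sub_self]
      rw [norm_smul]; norm_num; linarith

/-- A smooth compactly supported function equal to `‖v‖ ^ (2 s)` on the annulus. -/
def powY (s : ℝ) (v : V) : ℝ :=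
  (cutoff ((1 / 2 : ℝ) • v) - cutoff ((4 : ℝ) • v)) * ‖v‖ ^ (2 * s)

lemma powY_eq (s : ℝ) {v : V} (h1 : 1 / 2 ≤ ‖v‖) (h2 : ‖v‖ ≤ 2) : powY s v = ‖v‖ ^ (2 * s) := by
  rw [powY, cutoff_eq_one, cutoff_eq_zero, sub_zero, one_mul]
  · rw [norm_smul]; norm_num; linarith
  · rw [norm_smul]; norm_num; linarith

lemma contDiff_powY (s : ℝ) : ContDiff ℝ ∞ (powY s : V → ℝ) := by
  rw [contDiff_iff_contDiffAt]
  intro v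
  by_cases hv : v = 0
  · have : powY s =ᶠ[nhds v] fun _ => (0 : ℝ) := by
      filter_upwards [Metric.ball_mem_nhds v (show (0 : ℝ) < 1 / 4 by norm_num)] with w hw
      rw [hv] at hw
      have hw : ‖w‖ < 1 / 4 := by simpa using hw
      rw [powY, cutoff_eq_one, cutoff_eq_one, sub_self, zero_mul]
      · rw [norm_smul]; norm_num; linarith
      · rw [norm_smul]; norm_num; linarith
    exact contDiffAt_const.congr_of_eventuallyEq this
  · refine ContDiffAt.mul ?_ ?_
    · exact ((contDiff_cutoff_smul _).sub (contDiff_cutoff_smul _)).contDiffAt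
    · exact (contDiffAt_norm ℝ hv).rpow_const_of_ne (norm_ne_zero_iff.2 hv)

lemma hasCompactSupport_powY (s : ℝ) : HasCompactSupport (powY s : V → ℝ) := by
  refine HasCompactSupport.intro (isCompact_closedBall (0 : V) 4) fun v hv => ?_
  have hv : 4 < ‖v‖ := by simpa using hv
  rw [powY, cutoff_eq_zero, cutoff_eq_zero, sub_self, zero_mul]
  · rw [norm_smul]; norm_num; linarith
  · rw [norm_smul]; norm_num; linarith

lemma powY_mem {s : ℝ} (hs : 0 < s) (hs1 : s ≤ 1) {v : V} (h1 : 1 / 2 ≤ ‖v‖) (h2 : ‖v‖ ≤ 2) :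
    powY s v ∈ Icc (1 / 4 : ℝ) 4 := by
  rw [powY_eq s h1 h2]
  constructor
  · calc (1 / 4 : ℝ) = (1 / 2) ^ (2 : ℝ) := by norm_num
      _ ≤ (1 / 2) ^ (2 * s) :=
        Real.rpow_le_rpow_of_exponent_ge (by norm_num) (by norm_num) (by linarith)
      _ ≤ _ := Real.rpow_le_rpow (by norm_num) h1 (by positivity)
  · calc ‖v‖ ^ (2 * s) ≤ 2 ^ (2 * s) := Real.rpow_le_rpow (by positivity) h2 (by positivity)
      _ ≤ 2 ^ (2 : ℝ) := Real.rpow_le_rpow_of_exponent_le (by norm_num) (by linarith)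
      _ = 4 := by norm_num

lemma isPiece_ofReal {f : V → ℝ} {a : ℝ} (hf : ContDiff ℝ ∞ f) (h0 : ∀ v, 2 < ‖v‖ → f v = 0)
    (hb : ∀ i ≤ finrank ℝ V + 1, ∀ v, ‖iteratedFDeriv ℝ i f v‖ ≤ a) :
    IsPiece (fun v => (f v : ℂ)) a where
  smooth := Complex.ofRealCLM.contDiff.comp hf
  eq_zero v hv := by simp [h0 v hv]
  bound i hi v := by
    have := LinearIsometry.norm_iteratedFDeriv_comp_left (𝕜 := ℝ) Complex.ofRealLI
      (f := f) (x := v) (i := i) (n := ∞) hf.contDiffAt (by exact_mod_cast le_top)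
    exact this.le.trans (hb i hi v)

lemma IsPiece.add {b b' : V → ℂ} {a a' : ℝ} (h : IsPiece b a) (h' : IsPiece b' a') :
    IsPiece (fun v => b v + b' v) (a + a') where
  smooth := h.smooth.add h'.smooth
  eq_zero v hv := by simp [h.eq_zero v hv, h'.eq_zero v hv]
  bound i hi v := by
    have : iteratedFDeriv ℝ i (fun v => b v + b' v) v = _ :=
      iteratedFDeriv_add_apply (h.smooth.of_le (by exact_mod_cast le_top)).contDiffAt
        (h'.smooth.of_le (by exact_mod_cast le_top)).contDiffAt
    rw [this]
    exact (norm_add_le _ _).trans (add_le_add (h.bound i hi v) (h'.bound i hi v))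

lemma IsPiece.mono {b : V → ℂ} {a a' : ℝ} (h : IsPiece b a) (ha : a ≤ a') : IsPiece b a' :=
  ⟨h.smooth, h.eq_zero, fun i hi v => (h.bound i hi v).trans ha⟩

lemma isPiece_zero : IsPiece (fun _ : V => (0 : ℂ)) 0 where
  smooth := contDiff_const
  eq_zero _ _ := rfl
  bound i _ v := by simp

lemma IsPiece.const_mul {b : V → ℂ} {a : ℝ} (h : IsPiece b a) {r : ℝ} (hr : 0 ≤ r) :
    IsPiece (fun v => (r : ℂ) * b v) (r * a) where
  smooth := contDiff_const.mul h.smooth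
  eq_zero v hv := by simp [h.eq_zero v hv]
  bound i hi v := by
    have : (fun v => (r : ℂ) * b v) = r • b := by ext v; simp
    rw [this, iteratedFDeriv_const_smul_apply
      (h.smooth.of_le (by exact_mod_cast le_top)).contDiffAt, norm_smul, Real.norm_of_nonneg hr]
    exact mul_le_mul_of_nonneg_left (h.bound i hi v) hr

lemma IsAnnular.exists_piece_exp {ϑ : V → ℝ} (h : IsAnnular ϑ) {s : ℝ} (hs : 0 < s) (hs1 : s ≤ 1)
    (N : ℕ) : ∃ C : ℝ, 0 < C ∧ ∀ l : ℝ, 0 < l →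
      IsPiece (fun v => ((ϑ v * Real.exp (-l * powY s v) : ℝ) : ℂ)) (C * (l ^ N)⁻¹) := by
  set M := finrank ℝ V + 1
  obtain ⟨C, hC, hb⟩ := h.exists_comp_bound (contDiff_powY s) (hasCompactSupport_powY s)
    (fun v h1 h2 => powY_mem hs hs1 h1 h2) M
  refine ⟨C * (4 ^ (M + N) * (M + N).factorial), by positivity, fun l hl => ?_⟩
  have hg : ContDiff ℝ ∞ fun y : ℝ => Real.exp (-l * y) := by fun_prop
  refine isPiece_ofReal (h.smooth.mul (hg.comp (contDiff_powY s)))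
    (fun v hv => by simp [h.eq_zero v (fun h' => absurd h'.2 (not_le.2 hv))]) fun i hi v => ?_
  rw [mul_assoc]
  exact hb _ _ hg (by positivity) (fun i hi y hy => iteratedDeriv_exp_neg_bound M N hl hi hy.1) i hi v

lemma IsAnnular.exists_piece_exp_sub_one {ϑ : V → ℝ} (h : IsAnnular ϑ) {s : ℝ} (hs : 0 < s)
    (hs1 : s ≤ 1) {B : ℝ} (hB : 1 ≤ B) : ∃ C : ℝ, 0 < C ∧ ∀ l : ℝ, 0 < l → l ≤ B →
      IsPiece (fun v => ((ϑ v * (-1 + Real.exp (-l * powY s v)) : ℝ) : ℂ)) (C * l) := by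
  set M := finrank ℝ V + 1
  obtain ⟨C, hC, hb⟩ := h.exists_comp_bound (contDiff_powY s) (hasCompactSupport_powY s)
    (fun v h1 h2 => powY_mem hs hs1 h1 h2) M
  refine ⟨C * (4 * B ^ M), by positivity, fun l hl hlB => ?_⟩
  have hg : ContDiff ℝ ∞ fun y : ℝ => -1 + Real.exp (-l * y) := by fun_prop
  refine isPiece_ofReal (h.smooth.mul (hg.comp (contDiff_powY s)))
    (fun v hv => by simp [h.eq_zero v (fun h' => absurd h'.2 (not_le.2 hv))]) fun i hi v => ?_
  rw [mul_assoc]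
  exact hb _ _ hg (by positivity)
    (fun i hi y hy => iteratedDeriv_exp_neg_sub_one_bound hl hlB hB hi hy) i hi v

lemma exists_piece_cutoff : ∃ C : ℝ, 0 < C ∧ IsPiece (fun v : V => ((cutoff v : ℝ) : ℂ)) C := by
  obtain ⟨C, hC, hb⟩ := exists_iteratedFDeriv_bound (V := V) contDiff_cutoff
    (HasCompactSupport.intro (isCompact_closedBall (0 : V) 2) fun v hv =>
      cutoff_eq_zero (by simpa using (not_le.1 (fun h => hv (by simpa using h))).le))
    (finrank ℝ V + 1)
  exact ⟨C, by linarith, isPiece_ofReal contDiff_cutoff (fun v hv => cutoff_eq_zero hv.le) hb⟩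

/-! ### Decay of the Fourier transforms of the symbols. -/

/-- The symbol `|ξ| ^ (2 s j) exp (-4 π² t |ξ| ^ (2 s))`. -/
def symbol (s : ℝ) (j : ℕ) (t : ℝ) (ξ : V) : ℝ :=
  (‖ξ‖ ^ (2 * s)) ^ j * Real.exp (-4 * Real.pi ^ 2 * t * ‖ξ‖ ^ (2 * s))

/-- The size of the `k`-th dyadic piece of the symbols. -/
def pieceSize (s : ℝ) (N : ℕ) (k : ℤ) : ℝ :=
  if 0 ≤ k then ((2 : ℝ) ^ k) ^ (-(2 * s)) else (((((2 : ℝ) ^ k) ^ (-(2 * s))) ^ N)⁻¹)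

lemma summable_pow_natAbs {r : ℝ} (h0 : 0 ≤ r) (h1 : r < 1) : Summable fun k : ℤ => r ^ k.natAbs := by
  apply Summable.of_nat_of_neg <;> simpa using summable_geometric_of_lt_one h0 h1

lemma two_zpow_rpow_neg {s : ℝ} {k : ℤ} (hk : 0 ≤ k) :
    ((2 : ℝ) ^ k) ^ (-s) = ((2 : ℝ) ^ (-s)) ^ k.natAbs := by
  obtain ⟨m, rfl⟩ := Int.eq_ofNat_of_zero_le hk
  simp only [zpow_natCast, Int.natAbs_natCast]
  rw [← Real.rpow_natCast, ← Real.rpow_natCast, ← Real.rpow_mul (by norm_num),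
    ← Real.rpow_mul (by norm_num), mul_comm]

lemma two_zpow_rpow {s : ℝ} {k : ℤ} (hk : k ≤ 0) :
    ((2 : ℝ) ^ k) ^ s = ((2 : ℝ) ^ (-s)) ^ k.natAbs := by
  have := two_zpow_rpow_neg (s := s) (k := -k) (by omega)
  rw [Int.natAbs_neg] at this
  rw [← this, zpow_neg, Real.inv_rpow (by positivity), Real.rpow_neg (by positivity), inv_inv]

/-- With `z = 2 ^ k`, the general term for `k ≥ 0` is at most `2 z ^ (-2 s) z ^ s = 2 z ^ (-s)`. For
`k < 0` it is at most `2 z ^ (2 s N - (d + 1))`, and the choice of `N` leaves an exponent at least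
`1 ≥ s`. Both sides are geometric. -/
lemma summable_pieceSize {s : ℝ} (hs : 0 < s) (hs1 : s ≤ 1) (d : ℕ) {N : ℕ}
    (hN : (d : ℝ) + 2 ≤ 2 * s * N) :
    Summable fun k => pieceSize s N k * dyadicWeight d s ((2 : ℝ) ^ k) := by
  have hr : (2 : ℝ) ^ (-s) < 1 := Real.rpow_lt_one_of_one_lt_of_neg (by norm_num) (by linarith)
  refine Summable.of_nonneg_of_le (fun k => ?_) (fun k => ?_)
    ((summable_pow_natAbs (by positivity) hr).mul_left 2)
  · unfold pieceSize dyadicWeight; split_ifs <;> positivity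
  have hd : (0 : ℝ) ≤ d := by positivity
  set z : ℝ := 2 ^ k with hzdef
  have hz : 0 < z := by positivity
  unfold pieceSize
  split_ifs with hk
  · have h1 : 1 ≤ z := one_le_zpow₀ (by norm_num) hk
    rw [← two_zpow_rpow_neg hk, ← hzdef]
    have : dyadicWeight d s z ≤ 2 * z ^ s := by
      have : z ^ (-((d : ℝ) + 1)) ≤ z ^ s := Real.rpow_le_rpow_of_exponent_le h1 (by linarith)
      unfold dyadicWeight; linarith
    calc _ ≤ z ^ (-(2 * s)) * (2 * z ^ s) := by gcongr
      _ = 2 * (z ^ (-(2 * s)) * z ^ s) := by ring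
      _ = 2 * z ^ (-s) := by rw [← Real.rpow_add hz]; congr 2; ring
  · push Not at hk
    have h1 : z ≤ 1 := zpow_le_one_of_nonpos₀ (by norm_num) hk.le
    rw [← two_zpow_rpow hk.le, ← hzdef]
    have : dyadicWeight d s z ≤ 2 * z ^ (-((d : ℝ) + 1)) := by
      have : z ^ s ≤ z ^ (-((d : ℝ) + 1)) := Real.rpow_le_rpow_of_exponent_ge hz h1 (by linarith)
      unfold dyadicWeight; linarith
    have e : ((z ^ (-(2 * s))) ^ N)⁻¹ = z ^ (2 * s * N) := by
      rw [← Real.rpow_natCast, ← Real.rpow_mul hz.le, ← Real.rpow_neg hz.le]; congr 1; ring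
    rw [e]
    calc _ ≤ z ^ (2 * s * N) * (2 * z ^ (-((d : ℝ) + 1))) := by gcongr
      _ = 2 * (z ^ (2 * s * N) * z ^ (-((d : ℝ) + 1))) := by ring
      _ = 2 * z ^ (2 * s * N - (d + 1)) := by rw [← Real.rpow_add hz]; rfl
      _ ≤ 2 * z ^ s := by
        gcongr 2 * ?_
        exact Real.rpow_le_rpow_of_exponent_ge hz h1 (by linarith)

lemma exists_zpow_bounds {x : ℝ} (hx : 0 < x) :
    ∃ K : ℕ, (∀ k : ℤ, k ≤ -K → (2 : ℝ) ^ k * x ≤ 1) ∧ ∀ k : ℤ, (K : ℤ) ≤ k → 2 ≤ (2 : ℝ) ^ k * x := by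
  obtain ⟨A, hA⟩ := pow_unbounded_of_one_lt x (show (1 : ℝ) < 2 by norm_num)
  obtain ⟨B, hB⟩ := pow_unbounded_of_one_lt (2 / x) (show (1 : ℝ) < 2 by norm_num)
  refine ⟨A + B, fun k hk => ?_, fun k hk => ?_⟩
  · have h1 : (2 : ℝ) ^ k ≤ 2 ^ (-(A : ℤ)) :=
      zpow_le_zpow_right₀ (by norm_num) (by push_cast at hk; omega)
    rw [zpow_neg, zpow_natCast] at h1
    calc _ ≤ ((2 : ℝ) ^ A)⁻¹ * 2 ^ A := by gcongr
      _ = 1 := inv_mul_cancel₀ (by positivity)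
  · have h1 : (2 : ℝ) ^ (B : ℤ) ≤ 2 ^ k :=
      zpow_le_zpow_right₀ (by norm_num) (by push_cast at hk; omega)
    rw [zpow_natCast] at h1
    rw [div_lt_iff₀ hx] at hB
    nlinarith

lemma norm_zpow_smul (k : ℤ) (ξ : V) : ‖(2 : ℝ) ^ k • ξ‖ = 2 ^ k * ‖ξ‖ := by
  rw [norm_smul, Real.norm_of_nonneg (by positivity)]

lemma ring1_zpow (k : ℤ) (ξ : V) :
    ring1 ((2 : ℝ) ^ k • ξ) = cutoff ((2 : ℝ) ^ k • ξ) - cutoff ((2 : ℝ) ^ (k + 1) • ξ) := by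
  rw [ring1, smul_smul, zpow_add_one₀ (by norm_num), mul_comm (2 : ℝ)]

lemma hasSum_ring1 {ξ : V} (hξ : ξ ≠ 0) : HasSum (fun k : ℤ => ring1 ((2 : ℝ) ^ k • ξ)) 1 := by
  obtain ⟨K, h0, h1⟩ := exists_zpow_bounds (norm_pos_iff.2 hξ)
  simp only [ring1_zpow]
  exact hasSum_int_telescope (f := fun k : ℤ => cutoff ((2 : ℝ) ^ k • ξ)) (K := K)
    (fun k hk => cutoff_eq_one (by rw [norm_zpow_smul]; exact h0 k hk))
    (fun k hk => cutoff_eq_zero (by rw [norm_zpow_smul]; exact h1 k hk))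

/-- The telescoping sum is stopped at `k = 0`. Subtracting `1` from the symbol on the low-frequency
pieces `k ≥ 0` thus removes exactly `cutoff`, which can be restored as a single smooth piece. -/
lemma hasSum_ring1_nonneg {ξ : V} (hξ : ξ ≠ 0) :
    HasSum (fun k : ℤ => if 0 ≤ k then ring1 ((2 : ℝ) ^ k • ξ) else 0) (cutoff ξ) := by
  obtain ⟨K, -, h1⟩ := exists_zpow_bounds (norm_pos_iff.2 hξ)
  convert hasSum_int_telescope (f := fun k : ℤ => cutoff ((2 : ℝ) ^ (max k 0) • ξ)) (A := cutoff ξ)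
    (K := K) (fun k hk => ?_) (fun k hk => ?_) using 2 with k
  · split_ifs with hk
    · rw [ring1_zpow, max_eq_left hk, max_eq_left (by omega)]
    · rw [max_eq_right (by omega), max_eq_right (by omega), sub_self]
  · rw [max_eq_right (by omega)]; simp
  · refine cutoff_eq_zero ?_
    rw [norm_zpow_smul]
    exact h1 _ (by omega)

/-- On the support of `ring1 (z • ·)`, homogeneity gives `‖ξ‖ ^ (2 s) = z ^ (-2 s) ‖z • ξ‖ ^ (2 s)`.
A function of `‖ξ‖ ^ (2 s)` therefore becomes, after rescaling, a function of `powY`, which is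
smooth also at the origin. -/
lemma ring1_mul_eq {s : ℝ} {ξ : V} {z : ℝ} (hz : 0 < z) (F : ℝ → ℝ) :
    ring1 (z • ξ) * F (z ^ (-(2 * s)) * powY s (z • ξ)) = ring1 (z • ξ) * F (‖ξ‖ ^ (2 * s)) := by
  by_cases h : 1 / 2 ≤ ‖z • ξ‖ ∧ ‖z • ξ‖ ≤ 2
  · rw [powY_eq s h.1 h.2, norm_smul, Real.norm_of_nonneg hz.le,
      Real.mul_rpow hz.le (norm_nonneg _), ← mul_assoc, ← Real.rpow_add hz]
    simp
  · simp [isAnnular_ring1.eq_zero _ h]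

lemma isAnnular_ring1_mul_pow (s : ℝ) (j : ℕ) :
    IsAnnular fun v : V => ring1 v * powY s v ^ j where
  smooth := isAnnular_ring1.smooth.mul ((contDiff_powY s).pow j)
  eq_zero v hv := by simp [isAnnular_ring1.eq_zero v hv]

lemma one_le_four_pi_sq : 1 ≤ 4 * Real.pi ^ 2 := by nlinarith [Real.pi_gt_three]

/-- Decay of the Fourier transforms of the symbols at time `1`. -/
theorem decaysLip_symbol [Nontrivial V] {s : ℝ} (hs : 0 < s) (hs1 : s ≤ 1) (j : ℕ) :
    DecaysLip (finrank ℝ V + s) (𝓕 fun ξ : V => ((symbol s j 1 ξ : ℝ) : ℂ)) := by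
  set d := finrank ℝ V
  set c : ℝ := 4 * Real.pi ^ 2
  have hc : 1 ≤ c := one_le_four_pi_sq
  obtain ⟨N, hN⟩ := exists_nat_ge (((d : ℝ) + 2) / (2 * s))
  rw [div_le_iff₀ (by positivity), mul_comm] at hN
  have hsum := summable_pieceSize hs hs1 d hN
  have hl : ∀ k : ℤ, 0 < ((2 : ℝ) ^ k) ^ (-(2 * s)) := fun k => by positivity
  have hl1 : ∀ k : ℤ, 0 ≤ k → ((2 : ℝ) ^ k) ^ (-(2 * s)) ≤ 1 := fun k hk =>
    Real.rpow_le_one_of_one_le_of_nonpos (one_le_zpow₀ (by norm_num) hk) (by linarith)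
  rcases Nat.eq_zero_or_pos j with rfl | hj
  · obtain ⟨C₁, hC₁, hp₁⟩ := (isAnnular_ring1 (V := V)).exists_piece_exp hs hs1 N
    obtain ⟨C₂, hC₂, hp₂⟩ := (isAnnular_ring1 (V := V)).exists_piece_exp_sub_one hs hs1 hc
    obtain ⟨C₃, hC₃, hp₃⟩ := exists_piece_cutoff (V := V)
    -- For `j = 0` the symbol tends to `1` at the origin, so its pieces do not shrink at low
    -- frequencies. The constant `1` is subtracted for `k ≥ 0`, and the removed total `cutoff` is
    -- put into the piece `k = 0`.
    let b : ℤ → V → ℂ := fun k v =>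
      ((if 0 ≤ k then ring1 v * (-1 + Real.exp (-(c * ((2 : ℝ) ^ k) ^ (-(2 * s))) * powY s v))
        else ring1 v * Real.exp (-(c * ((2 : ℝ) ^ k) ^ (-(2 * s))) * powY s v) : ℝ) : ℂ)
      + (if k = 0 then ((cutoff v : ℝ) : ℂ) else 0)
    refine decaysLip_of_hasSum_pieces (b := b)
      (a := fun k => (C₁ + C₂ * c + C₃) * pieceSize s N k) hs.le hs1 (fun k => ?_) ?_ (fun ξ hξ => ?_)
    · have hpos := hl k
      have hps : 0 ≤ pieceSize s N k := by unfold pieceSize; split_ifs <;> positivity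
      have e : (C₁ + C₂ * c + C₃) * pieceSize s N k =
        (C₁ + C₂ * c) * pieceSize s N k + C₃ * pieceSize s N k := by ring
      rw [e]
      refine IsPiece.add ?_ ?_
      · unfold pieceSize
        split_ifs with hk
        · refine (hp₂ _ (by positivity) ?_).mono ?_
          · exact mul_le_of_le_one_right (by linarith) (hl1 k hk)
          · nlinarith [mul_pos hC₁ hpos]
        · refine (hp₁ _ (by positivity)).mono ?_
          have : ((c * ((2 : ℝ) ^ k) ^ (-(2 * s))) ^ N)⁻¹ ≤ ((((2 : ℝ) ^ k) ^ (-(2 * s))) ^ N)⁻¹ := by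
            gcongr
            exact le_mul_of_one_le_left hpos.le hc
          have hq : 0 < ((((2 : ℝ) ^ k) ^ (-(2 * s))) ^ N)⁻¹ := by positivity
          calc _ ≤ C₁ * ((((2 : ℝ) ^ k) ^ (-(2 * s))) ^ N)⁻¹ := by gcongr
            _ ≤ _ := by gcongr; nlinarith
      · by_cases hk : k = 0
        · subst hk
          simp only [if_true]
          refine hp₃.mono ?_
          simp [pieceSize]
        · simp only [hk, if_false]
          exact isPiece_zero.mono (by positivity)
    · simpa only [mul_assoc] using hsum.mul_left (C₁ + C₂ * c + C₃)
    · have h1 := (hasSum_ring1 hξ).mul_right (symbol s 0 1 ξ)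
      have h2 := hasSum_ring1_nonneg hξ
      have h3 : HasSum (fun k : ℤ => if k = 0 then cutoff ξ else 0) (cutoff ξ) :=
        hasSum_ite_eq 0 _
      have h4 := (h1.sub h2).add h3
      rw [one_mul, sub_add_cancel] at h4
      convert Complex.hasSum_ofReal.2 h4 using 2 with k
      have hz : (0 : ℝ) < 2 ^ k := by positivity
      have e := ring1_mul_eq (s := s) (ξ := ξ) hz (fun y => Real.exp (-c * y))
      have e1 : ring1 ((2 : ℝ) ^ k • ξ) * symbol s 0 1 ξ = ring1 ((2 : ℝ) ^ k • ξ) *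
          Real.exp (-(c * ((2 : ℝ) ^ k) ^ (-(2 * s))) * powY s ((2 : ℝ) ^ k • ξ)) := by
        have e2 : symbol s 0 1 ξ = Real.exp (-c * ‖ξ‖ ^ (2 * s)) := by
          simp [symbol, c]
        rw [e2, ← e]
        congr 2; ring
      rw [e1]
      simp only [b]
      have hk0 : (k = 0) → cutoff ((2 : ℝ) ^ k • ξ) = cutoff ξ := by rintro rfl; simp
      split_ifs with hk hk' hk'
      · rw [hk0 hk']; push_cast; ring
      · push_cast; ring
      · omega
      · push_cast; ring
  · have hann := isAnnular_ring1_mul_pow (V := V) s j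
    obtain ⟨C₁, hC₁, hp₁⟩ := hann.exists_piece_exp hs hs1 0
    obtain ⟨C₂, hC₂, hp₂⟩ := hann.exists_piece_exp hs hs1 (N + j)
    -- For `j ≥ 1` the symbol vanishes at the origin: with `l = z ^ (-2 s)`, the prefactor satisfies
    -- `l ^ j ≤ l` for `k ≥ 0`. For `k < 0` this prefactor is large and is absorbed by taking decay
    -- of order `N + j` in the exponential.
    let b : ℤ → V → ℂ := fun k v => (((((2 : ℝ) ^ k) ^ (-(2 * s))) ^ j : ℝ) : ℂ) *
      ((ring1 v * powY s v ^ j * Real.exp (-(c * ((2 : ℝ) ^ k) ^ (-(2 * s))) * powY s v) : ℝ) : ℂ)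
    refine decaysLip_of_hasSum_pieces (b := b)
      (a := fun k => (C₁ + C₂) * pieceSize s N k) hs.le hs1 (fun k => ?_) ?_ (fun ξ hξ => ?_)
    · have hpos := hl k
      unfold pieceSize
      split_ifs with hk
      · refine ((hp₁ _ (by positivity)).const_mul (by positivity)).mono ?_
        have : (((2 : ℝ) ^ k) ^ (-(2 * s))) ^ j ≤ ((2 : ℝ) ^ k) ^ (-(2 * s)) :=
          pow_le_of_le_one hpos.le (hl1 k hk) hj.ne'
        rw [pow_zero, inv_one, mul_one]
        nlinarith
      · refine ((hp₂ _ (by positivity)).const_mul (by positivity)).mono ?_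
        set l := ((2 : ℝ) ^ k) ^ (-(2 * s))
        have h1 : ((c * l) ^ (N + j))⁻¹ ≤ (l ^ (N + j))⁻¹ := by
          gcongr
          exact le_mul_of_one_le_left hpos.le hc
        calc l ^ j * (C₂ * ((c * l) ^ (N + j))⁻¹) ≤ l ^ j * (C₂ * (l ^ (N + j))⁻¹) := by gcongr
          _ = C₂ * (l ^ N)⁻¹ := by rw [pow_add]; field_simp
          _ ≤ _ := by gcongr; linarith
    · simpa only [mul_assoc] using hsum.mul_left (C₁ + C₂)
    · have h1 := (hasSum_ring1 hξ).mul_right (symbol s j 1 ξ)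
      rw [one_mul] at h1
      convert Complex.hasSum_ofReal.2 h1 using 2 with k
      have hz : (0 : ℝ) < 2 ^ k := by positivity
      have e := ring1_mul_eq (s := s) (ξ := ξ) hz (fun y => y ^ j * Real.exp (-c * y))
      have e2 : symbol s j 1 ξ = (‖ξ‖ ^ (2 * s)) ^ j * Real.exp (-c * ‖ξ‖ ^ (2 * s)) := by
        simp [symbol, c]
      rw [e2, ← e]
      simp only [b]
      rw [← Complex.ofReal_mul, mul_pow]
      congr 1
      rw [show -(c * ((2 : ℝ) ^ k) ^ (-(2 * s))) * powY s ((2 : ℝ) ^ k • ξ) =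
        -c * (((2 : ℝ) ^ k) ^ (-(2 * s)) * powY s ((2 : ℝ) ^ k • ξ)) by ring]
      ring

end Frequency

/-! ### The heat profile and its time derivatives in the slab. -/

section Profile

variable {V : Type*} [NormedAddCommGroup V] [InnerProductSpace ℝ V] [FiniteDimensional ℝ V]
  [MeasurableSpace V] [BorelSpace V]

lemma symbol_nonneg (s : ℝ) (j : ℕ) (t : ℝ) (ξ : V) : 0 ≤ symbol s j t ξ := by
  unfold symbol; positivity

lemma integrable_symbol [Nontrivial V] {s : ℝ} (hs : 0 < s) (j : ℕ) {t : ℝ} (ht : 0 < t) :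
    Integrable (symbol s j t : V → ℝ) := by
  have h : Integrable (fun ξ : V => (fun y : ℝ => (y ^ (2 * s)) ^ j *
      Real.exp (-4 * Real.pi ^ 2 * t * y ^ (2 * s))) ‖ξ‖) := by
    rw [integrable_fun_norm_addHaar (volume : Measure V)
      (f := fun y : ℝ => (y ^ (2 * s)) ^ j * Real.exp (-4 * Real.pi ^ 2 * t * y ^ (2 * s)))]
    have hq : (-1 : ℝ) < (finrank ℝ V - 1 : ℕ) + 2 * s * j := by
      have : (0 : ℝ) ≤ (finrank ℝ V - 1 : ℕ) + 2 * s * j := by positivity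
      linarith
    have := integrableOn_rpow_mul_exp_neg_mul_rpow hq (show 0 < 2 * s by positivity)
      (show 0 < 4 * Real.pi ^ 2 * t by positivity)
    refine this.congr_fun (fun y hy => ?_) measurableSet_Ioi
    have hy : 0 < y := hy
    simp only [smul_eq_mul]
    rw [Real.rpow_add hy, Real.rpow_natCast, Real.rpow_mul hy.le, Real.rpow_natCast]
    ring_nf
  exact h

/-- The inverse Fourier transform of the symbol, `(4 π²)⁻ʲ (-∂_t)ʲ P_s`. -/
def profile (s : ℝ) (j : ℕ) (t : ℝ) (x : V) : ℝ :=
  (𝓕⁻ (fun ξ : V => ((symbol s j t ξ : ℝ) : ℂ)) x).re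

lemma symbol_smul {s : ℝ} (j : ℕ) (t : ℝ) {z : ℝ} (hz : 0 < z) (ξ : V) :
    symbol s j t (z • ξ) = z ^ (2 * s * j) * symbol s j (z ^ (2 * s) * t) ξ := by
  unfold symbol
  rw [norm_smul, Real.norm_of_nonneg hz.le, Real.mul_rpow hz.le (norm_nonneg _), mul_pow,
    Real.rpow_mul hz.le (2 * s) j, Real.rpow_natCast]
  ring_nf

/-- A dilation of the frequency variable multiplies the time in the symbol by `z ^ (2 s)`. This is
the self-similarity that reduces every time, and every dyadic scale, to a fixed one. -/
lemma profile_scaling {s : ℝ} (j : ℕ) (t : ℝ) {z : ℝ} (hz : 0 < z) (x : V) :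
    profile s j (z ^ (2 * s) * t) x =
      z ^ (-(finrank ℝ V + 2 * s * j)) * profile s j t (z⁻¹ • x) := by
  have h := fourier_comp_smul (fun ξ : V => ((symbol s j t ξ : ℝ) : ℂ)) hz (-x)
  have e : (fun ξ : V => ((symbol s j t (z • ξ) : ℝ) : ℂ)) =
      ((z ^ (2 * s * j) : ℝ) : ℂ) • fun ξ : V => ((symbol s j (z ^ (2 * s) * t) ξ : ℝ) : ℂ) := by
    ext ξ
    rw [symbol_smul j t hz, Pi.smul_apply, smul_eq_mul, Complex.ofReal_mul]
  rw [e] at h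
  have h2 : 𝓕 (((z ^ (2 * s * j) : ℝ) : ℂ) • fun ξ : V =>
      ((symbol s j (z ^ (2 * s) * t) ξ : ℝ) : ℂ)) (-x) = ((z ^ (2 * s * j) : ℝ) : ℂ) *
        𝓕 (fun ξ : V => ((symbol s j (z ^ (2 * s) * t) ξ : ℝ) : ℂ)) (-x) := by
    rw [Real.fourier_eq, Real.fourier_eq, ← integral_const_mul]
    congr 1
    ext v
    simp only [Pi.smul_apply, smul_eq_mul, Circle.smul_def]
    ring
  rw [h2] at h
  unfold profile
  rw [Real.fourierInv_eq_fourier_neg, Real.fourierInv_eq_fourier_neg, ← smul_neg]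
  have h3 := congrArg Complex.re h
  rw [Complex.re_ofReal_mul, Complex.re_ofReal_mul] at h3
  have hp : 0 < z ^ (2 * s * j) := by positivity
  rw [neg_add, Real.rpow_add hz, mul_right_comm, ← h3, Real.rpow_neg hz.le (2 * s * j)]
  field_simp

/-- The spatial weight. -/
def spaceWeight (s : ℝ) (x : V) : ℝ := (1 + ‖x‖) ^ (-((finrank ℝ V : ℝ) + s))

lemma spaceWeight_pos (s : ℝ) (x : V) : 0 < spaceWeight s x := by
  unfold spaceWeight; positivity

/-- Scaling by `z = t ^ (1 / (2 s))` reduces to time `1`. On `1 ≤ t ≤ 8` the factor `z` is bounded,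
which costs a constant in the weight, and `z ≥ 1` makes the dilation contract, so that increments of
size at most one remain so. -/
lemma profile_bound [Nontrivial V] {s : ℝ} (hs : 0 < s) (hs1 : s ≤ 1) (j : ℕ) :
    ∃ C : ℝ, 0 < C ∧ ∀ t ∈ Icc (1 : ℝ) 8, (∀ x : V, |profile s j t x| ≤ C * spaceWeight s x) ∧
      ∀ x y : V, ‖x - y‖ ≤ 1 → |profile s j t x - profile s j t y| ≤
        C * ‖x - y‖ * spaceWeight s x := by
  obtain ⟨C, hC, h0, h1⟩ := decaysLip_symbol (V := V) hs hs1 j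
  set d := finrank ℝ V
  have hB : (0 : ℝ) < 8 ^ (1 / (2 * s)) := by positivity
  refine ⟨C * (8 ^ (1 / (2 * s))) ^ ((d : ℝ) + s), by positivity, fun t ht => ?_⟩
  have ht0 : 0 < t := by linarith [ht.1]
  set z : ℝ := t ^ (1 / (2 * s)) with hzdef
  have hz : 0 < z := by positivity
  have hz1 : 1 ≤ z := Real.one_le_rpow ht.1 (by positivity)
  have hzB : z ≤ 8 ^ (1 / (2 * s)) := Real.rpow_le_rpow ht0.le ht.2 (by positivity)
  have hzt : z ^ (2 * s) * 1 = t := by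
    rw [hzdef, ← Real.rpow_mul ht0.le]; field_simp; simp
  have hsc : ∀ x : V, profile s j t x =
      z ^ (-((d : ℝ) + 2 * s * j)) * profile s j 1 (z⁻¹ • x) := fun x => by
    conv_lhs => rw [← hzt]
    exact profile_scaling j 1 hz x
  have hfac : z ^ (-((d : ℝ) + 2 * s * j)) ≤ 1 :=
    Real.rpow_le_one_of_one_le_of_nonpos hz1 (by
      have : (0 : ℝ) ≤ d + 2 * s * j := by positivity
      linarith)
  have hfac0 : 0 < z ^ (-((d : ℝ) + 2 * s * j)) := by positivity
  have hw : ∀ x : V, (1 + ‖z⁻¹ • x‖) ^ (-((d : ℝ) + s)) ≤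
      (8 ^ (1 / (2 * s))) ^ ((d : ℝ) + s) * spaceWeight s x := by
    intro x
    have hds : 0 ≤ (d : ℝ) + s := by positivity
    have e1 : (1 + ‖x‖) / z ≤ 1 + ‖z⁻¹ • x‖ := by
      rw [norm_smul, norm_inv, Real.norm_of_nonneg hz.le, add_div, inv_mul_eq_div]
      gcongr
      exact (div_le_one hz).2 hz1
    calc (1 + ‖z⁻¹ • x‖) ^ (-((d : ℝ) + s)) ≤ ((1 + ‖x‖) / z) ^ (-((d : ℝ) + s)) :=
          Real.rpow_le_rpow_of_nonpos (by positivity) e1 (by linarith)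
      _ = z ^ ((d : ℝ) + s) * (1 + ‖x‖) ^ (-((d : ℝ) + s)) := by
          rw [Real.div_rpow (by positivity) hz.le, Real.rpow_neg hz.le, div_inv_eq_mul, mul_comm]
      _ ≤ _ := by
          unfold spaceWeight
          gcongr
  constructor
  · intro x
    rw [hsc, abs_mul, abs_of_pos hfac0]
    have h2 : |profile s j 1 (z⁻¹ • x)| ≤ C * (1 + ‖z⁻¹ • x‖) ^ (-((d : ℝ) + s)) := by
      unfold profile
      rw [Real.fourierInv_eq_fourier_neg]
      refine (Complex.abs_re_le_norm _).trans ((h0 _).trans_eq ?_)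
      rw [norm_neg]
    calc _ ≤ 1 * (C * (1 + ‖z⁻¹ • x‖) ^ (-((d : ℝ) + s))) := by gcongr
      _ ≤ 1 * (C * ((8 ^ (1 / (2 * s))) ^ ((d : ℝ) + s) * spaceWeight s x)) := by
          gcongr; exact hw x
      _ = _ := by ring
  · intro x y hxy
    rw [hsc, hsc, ← mul_sub, abs_mul, abs_of_pos hfac0]
    have hxy' : ‖z⁻¹ • x - z⁻¹ • y‖ ≤ ‖x - y‖ := by
      rw [← smul_sub, norm_smul, norm_inv, Real.norm_of_nonneg hz.le]
      exact mul_le_of_le_one_left (norm_nonneg _) (inv_le_one_of_one_le₀ hz1)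
    have h2 : |profile s j 1 (z⁻¹ • x) - profile s j 1 (z⁻¹ • y)| ≤
        C * ‖x - y‖ * (1 + ‖z⁻¹ • x‖) ^ (-((d : ℝ) + s)) := by
      unfold profile
      rw [Real.fourierInv_eq_fourier_neg, Real.fourierInv_eq_fourier_neg, ← Complex.sub_re]
      have e : -(z⁻¹ • x) - -(z⁻¹ • y) = -(z⁻¹ • x - z⁻¹ • y) := by abel
      refine (Complex.abs_re_le_norm _).trans ((h1 _ _ ?_).trans ?_)
      · rw [e, norm_neg]; exact hxy'.trans hxy
      · rw [e, norm_neg, norm_neg]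
        gcongr
    calc _ ≤ 1 * (C * ‖x - y‖ * (1 + ‖z⁻¹ • x‖) ^ (-((d : ℝ) + s))) := by gcongr
      _ ≤ 1 * (C * ‖x - y‖ * ((8 ^ (1 / (2 * s))) ^ ((d : ℝ) + s) * spaceWeight s x)) := by
          gcongr; exact hw x
      _ = _ := by ring

lemma hasDerivAt_symbol (s : ℝ) (j : ℕ) (t : ℝ) (ξ : V) :
    HasDerivAt (fun t => symbol s j t ξ) (-(4 * Real.pi ^ 2) * symbol s (j + 1) t ξ) t := by
  unfold symbol
  have h1 : HasDerivAt (fun t : ℝ => -4 * Real.pi ^ 2 * t * ‖ξ‖ ^ (2 * s))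
      (-4 * Real.pi ^ 2 * 1 * ‖ξ‖ ^ (2 * s)) t :=
    ((hasDerivAt_id t).const_mul _).mul_const _
  exact (h1.exp.const_mul ((‖ξ‖ ^ (2 * s)) ^ j)).congr_deriv (by ring)

lemma symbol_anti {s : ℝ} (j : ℕ) {t t' : ℝ} (h : t ≤ t') (ξ : V) :
    symbol s j t' ξ ≤ symbol s j t ξ := by
  unfold symbol
  have : 0 ≤ ‖ξ‖ ^ (2 * s) := by positivity
  gcongr ?_ * Real.exp ?_
  have h2 : 0 ≤ 4 * Real.pi ^ 2 * ‖ξ‖ ^ (2 * s) := by positivity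
  nlinarith

/-- Differentiation under the integral sign. The symbol decreases in time, so on `(t / 2, ∞)` the
derivative is dominated by its value at `t / 2`, which is integrable. -/
lemma hasDerivAt_profile [Nontrivial V] {s : ℝ} (hs : 0 < s) (j : ℕ) {t : ℝ} (ht : 0 < t) (x : V) :
    HasDerivAt (fun t => profile s j t x) (-(4 * Real.pi ^ 2) * profile s (j + 1) t x) t := by
  set c : ℝ := 4 * Real.pi ^ 2
  have hint : ∀ (i : ℕ) {r : ℝ}, 0 < r → Integrable fun ξ : V =>
      Real.fourierChar (inner ℝ ξ x) • ((symbol s i r ξ : ℝ) : ℂ) := fun i r hr => by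
    have h0 : Integrable fun ξ : V => ((symbol s i r ξ : ℝ) : ℂ) :=
      (integrable_symbol (V := V) hs i hr).ofReal
    have := (Real.fourierIntegral_convergent_iff (-x)).2 h0
    simpa using this
  have key := hasDerivAt_integral_of_dominated_loc_of_deriv_le (𝕜 := ℝ) (μ := (volume : Measure V))
    (F := fun t ξ => Real.fourierChar (inner ℝ ξ x) • ((symbol s j t ξ : ℝ) : ℂ))
    (F' := fun t ξ => Real.fourierChar (inner ℝ ξ x) • ((-c * symbol s (j + 1) t ξ : ℝ) : ℂ))
    (bound := fun ξ => c * symbol s (j + 1) (t / 2) ξ) (x₀ := t) (s := Ioi (t / 2))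
    (Ioi_mem_nhds (by linarith)) ?_ (hint j ht) ?_ ?_
    ((integrable_symbol hs (j + 1) (by positivity)).const_mul c) ?_
  · have h2 := key.2
    have h3 := (Complex.reCLM.hasFDerivAt.comp_hasDerivAt t h2)
    have e : (Complex.reCLM (∫ ξ : V, Real.fourierChar (inner ℝ ξ x) •
        ((-c * symbol s (j + 1) t ξ : ℝ) : ℂ))) = -c * profile s (j + 1) t x := by
      unfold profile
      rw [Real.fourierInv_eq, ← Complex.re_ofReal_mul, ← integral_const_mul]
      simp only [Complex.reCLM_apply]
      congr 2
      ext ξ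
      simp only [Circle.smul_def, smul_eq_mul]
      push_cast
      ring
    rw [e] at h3
    refine h3.congr_of_eventuallyEq (Filter.Eventually.of_forall fun r => ?_)
    simp [profile, Real.fourierInv_eq]
  · filter_upwards [Ioi_mem_nhds ht] with r hr
    exact (hint j hr).aestronglyMeasurable
  · have := ((hint (j + 1) ht).const_mul ((-c : ℝ) : ℂ)).aestronglyMeasurable
    refine this.congr (Filter.Eventually.of_forall fun ξ => ?_)
    simp only [Circle.smul_def, smul_eq_mul, Complex.ofReal_mul]
    ring
  · refine Filter.Eventually.of_forall fun ξ r hr => ?_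
    rw [Circle.norm_smul, Complex.norm_real, norm_mul, norm_neg, Real.norm_of_nonneg (by positivity),
      Real.norm_of_nonneg (symbol_nonneg _ _ _ _)]
    have := symbol_anti (s := s) (j + 1) (le_of_lt hr) ξ
    gcongr
  · refine Filter.Eventually.of_forall fun ξ r hr => ?_
    have h1 := (hasDerivAt_symbol s j r ξ).ofReal_comp
    have h2 := h1.const_mul ((Real.fourierChar (inner ℝ ξ x) : Circle) : ℂ)
    exact h2

/-- `F (x, t)` is supported in `1 ≤ t ≤ 8`, decays in `x`, and so do its spatial increments. -/
def IsSlab (s : ℝ) (F : V → ℝ → ℝ) : Prop :=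
  ∃ C : ℝ, 0 < C ∧ (∀ x t, t ∉ Icc (1 : ℝ) 8 → F x t = 0) ∧
    (∀ x t, |F x t| ≤ C * spaceWeight s x) ∧
    ∀ x y t, ‖x - y‖ ≤ 1 → |F x t - F y t| ≤ C * ‖x - y‖ * spaceWeight s x

lemma IsSlab.add {s : ℝ} {F G : V → ℝ → ℝ} (hF : IsSlab s F) (hG : IsSlab s G) :
    IsSlab s fun x t => F x t + G x t := by
  obtain ⟨C, hC, h0, h1, h2⟩ := hF
  obtain ⟨C', hC', h0', h1', h2'⟩ := hG
  refine ⟨C + C', by positivity, fun x t ht => by simp [h0 x t ht, h0' x t ht], fun x t => ?_,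
    fun x y t hxy => ?_⟩
  · rw [add_mul]; exact (abs_add_le _ _).trans (add_le_add (h1 x t) (h1' x t))
  · rw [add_sub_add_comm]
    refine (abs_add_le _ _).trans ((add_le_add (h2 x y t hxy) (h2' x y t hxy)).trans_eq ?_)
    ring

lemma IsSlab.const_mul {s : ℝ} {F : V → ℝ → ℝ} (hF : IsSlab s F) (a : ℝ) :
    IsSlab s fun x t => a * F x t := by
  obtain ⟨C, hC, h0, h1, h2⟩ := hF
  refine ⟨(|a| + 1) * C, by positivity, fun x t ht => by simp [h0 x t ht], fun x t => ?_,
    fun x y t hxy => ?_⟩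
  · rw [abs_mul, mul_assoc]
    have := h1 x t
    gcongr
    linarith
  · rw [← mul_sub, abs_mul, mul_assoc, mul_assoc]
    have := h2 x y t hxy
    rw [mul_assoc] at this
    gcongr
    linarith

/-- Smooth functions of time supported in `[1, 8]`. -/
def IsTimeCutoff (ψ : ℝ → ℝ) : Prop :=
  ContDiff ℝ ∞ ψ ∧ ∀ t, t ∉ Icc (1 : ℝ) 8 → ψ t = 0

lemma IsTimeCutoff.eventually {ψ : ℝ → ℝ} (h : IsTimeCutoff ψ) {t : ℝ} (ht : t ∉ Icc (1 : ℝ) 8) :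
    ψ =ᶠ[nhds t] fun _ => 0 := by
  filter_upwards [isClosed_Icc.isOpen_compl.mem_nhds ht] with r hr using h.2 r hr

lemma IsTimeCutoff.deriv {ψ : ℝ → ℝ} (h : IsTimeCutoff ψ) : IsTimeCutoff (deriv ψ) :=
  ⟨(contDiff_infty_iff_deriv.1 h.1).2, fun t ht => by
    rw [(h.eventually ht).deriv_eq]; simp⟩

lemma IsTimeCutoff.isSlab [Nontrivial V] {ψ : ℝ → ℝ} (h : IsTimeCutoff ψ) {s : ℝ} (hs : 0 < s)
    (hs1 : s ≤ 1) (j : ℕ) : IsSlab s fun (x : V) t => ψ t * profile s j t x := by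
  obtain ⟨C, hC, hb⟩ := profile_bound (V := V) hs hs1 j
  obtain ⟨A, hA⟩ := h.1.continuous.bounded_above_of_compact_support
    (HasCompactSupport.intro isCompact_Icc h.2)
  have hA0 : 0 ≤ A := (norm_nonneg _).trans (hA 0)
  refine ⟨(A + 1) * C, by positivity, fun x t ht => by simp [h.2 t ht], fun x t => ?_,
    fun x y t hxy => ?_⟩
  · have := spaceWeight_pos s x
    by_cases ht : t ∈ Icc (1 : ℝ) 8
    · rw [abs_mul, mul_assoc]
      have h1 := (hb t ht).1 x
      have h2 : |ψ t| ≤ A + 1 := (hA t).trans (by linarith)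
      gcongr
    · simp only [h.2 t ht, zero_mul, abs_zero]; positivity
  · have := spaceWeight_pos s x
    by_cases ht : t ∈ Icc (1 : ℝ) 8
    · rw [← mul_sub, abs_mul, mul_assoc, mul_assoc]
      have h1 := (hb t ht).2 x y hxy
      have h2 : |ψ t| ≤ A + 1 := (hA t).trans (by linarith)
      rw [mul_assoc] at h1
      gcongr
    · simp only [h.2 t ht, zero_mul, sub_zero, abs_zero]; positivity

lemma IsTimeCutoff.hasDerivAt [Nontrivial V] {ψ : ℝ → ℝ} (h : IsTimeCutoff ψ) {s : ℝ} (hs : 0 < s)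
    (j : ℕ) (x : V) (t : ℝ) : HasDerivAt (fun t => ψ t * profile s j t x)
      (_root_.deriv ψ t * profile s j t x
        + -(4 * Real.pi ^ 2) * (ψ t * profile s (j + 1) t x)) t := by
  by_cases ht : t ∈ Icc (1 : ℝ) 8
  · have h1 := (h.1.differentiable (by simp) t).hasDerivAt.mul
      (hasDerivAt_profile hs j (by linarith [ht.1] : 0 < t) x)
    exact h1.congr_deriv (by ring)
  -- Outside `[1, 8]` the cutoff vanishes on a neighbourhood, so nothing is required of the profile,
  -- in particular at times `t ≤ 0`.
  · rw [h.deriv.2 t ht, h.2 t ht]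
    simp only [zero_mul, mul_zero, add_zero]
    refine (hasDerivAt_const t (0 : ℝ)).congr_of_eventuallyEq ?_
    filter_upwards [h.eventually ht] with r hr
    simp [hr]

/-- The localized kernel has two time derivatives, all of them slab functions. -/
lemma IsTimeCutoff.exists_derivs [Nontrivial V] {ψ : ℝ → ℝ} (h : IsTimeCutoff ψ) {s : ℝ}
    (hs : 0 < s) (hs1 : s ≤ 1) : ∃ F₁ F₂ : V → ℝ → ℝ, IsSlab s F₁ ∧ IsSlab s F₂ ∧
      (∀ x t, HasDerivAt (fun t => ψ t * profile s 0 t x) (F₁ x t) t) ∧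
      ∀ x t, HasDerivAt (F₁ x) (F₂ x t) t := by
  set c : ℝ := -(4 * Real.pi ^ 2)
  refine ⟨fun x t => _root_.deriv ψ t * profile s 0 t x + c * (ψ t * profile s 1 t x),
    fun x t => (_root_.deriv (_root_.deriv ψ) t * profile s 0 t x
      + c * (_root_.deriv ψ t * profile s 1 t x)) + c * (_root_.deriv ψ t * profile s 1 t x
      + c * (ψ t * profile s 2 t x)), ?_, ?_, fun x t => h.hasDerivAt hs 0 x t, fun x t => ?_⟩
  · exact (h.deriv.isSlab hs hs1 0).add ((h.isSlab hs hs1 1).const_mul c)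
  · exact ((h.deriv.deriv.isSlab hs hs1 0).add ((h.deriv.isSlab hs hs1 1).const_mul c)).add
      (((h.deriv.isSlab hs hs1 1).add ((h.isSlab hs hs1 2).const_mul c)).const_mul c)
  · exact (h.deriv.hasDerivAt hs 0 x t).add ((h.hasDerivAt hs 1 x t).const_mul c)

end Profile

/-! ### Fractional time quotients of slab functions. -/

section Fractional

/-- The difference quotient of the fractional derivative of a function of one variable. -/
def fracQuot (β : ℝ) (f : ℝ → ℝ) (t u : ℝ) : ℝ := (f (t + u) - f t) / |u| ^ (1 + β)

/-- The temporal weight. -/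
def timeWeight (β t : ℝ) : ℝ := (1 + |t|) ^ (-(1 + β))

lemma timeWeight_pos (β t : ℝ) : 0 < timeWeight β t := by
  unfold timeWeight; positivity

lemma measurable_fracQuot {β : ℝ} {f : ℝ → ℝ} (hf : Continuous f) (t : ℝ) :
    Measurable (fracQuot β f t) := by
  have := hf.measurable
  unfold fracQuot
  fun_prop

/-- The function is `|u| ^ (-β)` near the origin, integrable as `β < 1`, and at most `2 |u| ^ (-(1 +
β))` at infinity, integrable as `β > 0`. -/
lemma integrable_min_div_rpow {β : ℝ} (hβ : 0 < β) (hβ1 : β < 1) :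
    Integrable fun u : ℝ => min |u| 2 / |u| ^ (1 + β) := by
  have h : Integrable (fun u : ℝ => (fun y : ℝ => min y 2 / y ^ (1 + β)) ‖u‖) := by
    rw [integrable_fun_norm_addHaar (volume : Measure ℝ) (f := fun y : ℝ => min y 2 / y ^ (1 + β))]
    simp only [finrank_self, Nat.sub_self, pow_zero, one_smul]
    have hm : Measurable fun y : ℝ => min y 2 / y ^ (1 + β) := by fun_prop
    rw [← Ioc_union_Ioi_eq_Ioi (zero_le_one (α := ℝ))]
    refine IntegrableOn.union ?_ ?_
    · have h1 : IntegrableOn (fun y : ℝ => y ^ (-β)) (Ioc 0 1) :=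
        (intervalIntegrable_iff_integrableOn_Ioc_of_le zero_le_one).1
          (intervalIntegral.intervalIntegrable_rpow' (by linarith))
      refine Integrable.mono' h1 hm.aestronglyMeasurable ?_
      refine (ae_restrict_iff' measurableSet_Ioc).2 (Filter.Eventually.of_forall fun y hy => ?_)
      have hy0 : 0 < y := hy.1
      rw [Real.norm_of_nonneg (by positivity), Real.rpow_add hy0, Real.rpow_one,
        Real.rpow_neg hy0.le, div_le_iff₀ (by positivity)]
      have : min y 2 ≤ y := min_le_left _ _
      refine this.trans_eq ?_
      field_simp
    · have h1 : IntegrableOn (fun y : ℝ => 2 * y ^ (-(1 + β))) (Ioi 1) :=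
        (integrableOn_Ioi_rpow_of_lt (by linarith) one_pos).const_mul 2
      refine Integrable.mono' h1 hm.aestronglyMeasurable ?_
      refine (ae_restrict_iff' measurableSet_Ioi).2 (Filter.Eventually.of_forall fun y hy => ?_)
      have hy0 : 0 < y := zero_lt_one.trans hy
      rw [Real.norm_of_nonneg (by positivity), Real.rpow_neg hy0.le, div_eq_mul_inv]
      gcongr
      exact min_le_right _ _
  exact h

/-- Fractional quotients of a compactly supported Lipschitz function. -/
lemma exists_lintegral_fracQuot_le {β : ℝ} (hβ : 0 < β) (hβ1 : β < 1) :
    ∃ C : ℝ, 0 < C ∧ ∀ (f : ℝ → ℝ) (M : ℝ), 0 ≤ M → (∀ t, t ∉ Icc (0 : ℝ) 9 → f t = 0) →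
      (∀ t, |f t| ≤ M) → (∀ t r, |f t - f r| ≤ M * |t - r|) →
      ∀ t, ∫⁻ u, ‖fracQuot β f t u‖ₑ ≤ ENNReal.ofReal (C * M * timeWeight β t) := by
  set I := ∫ u : ℝ, min |u| 2 / |u| ^ (1 + β)
  have hI : 0 ≤ I := integral_nonneg fun u => by positivity
  refine ⟨I * 21 ^ (1 + β) + 9 * 4 ^ (1 + β), by positivity, fun f M hM h0 h1 h2 t => ?_⟩
  have hw := timeWeight_pos β t
  rcases le_or_gt |t| 20 with ht | ht
  -- Near the support the numerator is at most `M min |u| 2`, by the Lipschitz and the sup bounds.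
  -- The weight is bounded below by `21 ^ (-(1 + β))` here.
  · have hpt : ∀ u, ‖fracQuot β f t u‖ₑ ≤ ENNReal.ofReal (M * (min |u| 2 / |u| ^ (1 + β))) := by
      intro u
      rw [Real.enorm_eq_ofReal_abs]
      refine ENNReal.ofReal_le_ofReal ?_
      unfold fracQuot
      rw [abs_div, abs_of_nonneg (show 0 ≤ |u| ^ (1 + β) by positivity), ← mul_div_assoc]
      gcongr
      rw [mul_min_of_nonneg _ _ hM]
      refine le_min ?_ ?_
      · simpa using h2 (t + u) t
      · have := h1 (t + u)
        have := h1 t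
        exact (abs_sub _ _).trans (by linarith)
    refine (lintegral_mono hpt).trans ?_
    rw [← ofReal_integral_eq_lintegral_ofReal ((integrable_min_div_rpow hβ hβ1).const_mul M)
      (Filter.Eventually.of_forall fun u => by positivity), integral_const_mul]
    refine ENNReal.ofReal_le_ofReal ?_
    have h21 : 1 ≤ 21 ^ (1 + β) * timeWeight β t := by
      unfold timeWeight
      rw [Real.rpow_neg (by positivity), ← div_eq_mul_inv, one_le_div (by positivity)]
      exact Real.rpow_le_rpow (by positivity) (by linarith) (by linarith)
    calc M * I ≤ M * I * (21 ^ (1 + β) * timeWeight β t) := le_mul_of_one_le_right (by positivity) h21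
      _ = I * 21 ^ (1 + β) * M * timeWeight β t := by ring
      _ ≤ _ := by gcongr; linarith [show (0 : ℝ) ≤ 9 * 4 ^ (1 + β) by positivity]
  -- Far from the support `f t = 0`, so only increments reaching `[0, 9]` count: they fill an
  -- interval of length `9` and have size at least `|t| - 9 ≥ (1 + |t|) / 4`.
  · have hft : f t = 0 := h0 t fun h => by
      rw [abs_of_nonneg h.1] at ht; linarith [h.2]
    have hpt : ∀ u, ‖fracQuot β f t u‖ₑ ≤ (Icc (-t) (9 - t)).indicator
        (fun _ => ENNReal.ofReal (M * (4 ^ (1 + β) * timeWeight β t))) u := by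
      intro u
      by_cases hu : u ∈ Icc (-t) (9 - t)
      · rw [indicator_of_mem hu, Real.enorm_eq_ofReal_abs]
        refine ENNReal.ofReal_le_ofReal ?_
        unfold fracQuot
        have hu' : (1 + |t|) / 4 ≤ |u| := by
          have e : |t| ≤ |u| + 9 := by
            have : |t| ≤ |u| + |t + u| := by
              have := abs_sub (t + u) u
              simp only [add_sub_cancel_right] at this
              linarith
            have h9 : |t + u| ≤ 9 := abs_le.2 ⟨by linarith [hu.1], by linarith [hu.2]⟩
            linarith
          linarith
        rw [hft, sub_zero, abs_div, abs_of_nonneg (show 0 ≤ |u| ^ (1 + β) by positivity),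
          div_eq_mul_inv]
        gcongr
        · exact h1 _
        · calc (|u| ^ (1 + β))⁻¹ ≤ (((1 + |t|) / 4) ^ (1 + β))⁻¹ := by gcongr
            _ = _ := by
              unfold timeWeight
              rw [Real.div_rpow (by positivity) (by norm_num), Real.rpow_neg (by positivity), inv_div,
                div_eq_mul_inv]
      · have : f (t + u) = 0 := h0 _ fun h => hu ⟨by linarith [h.1], by linarith [h.2]⟩
        simp [fracQuot, this, hft]
    refine (lintegral_mono hpt).trans ?_
    rw [lintegral_indicator measurableSet_Icc, lintegral_const, Measure.restrict_apply_univ,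
      Real.volume_Icc, ← ENNReal.ofReal_mul (by positivity)]
    refine ENNReal.ofReal_le_ofReal ?_
    have : 0 ≤ I * 21 ^ (1 + β) * M * timeWeight β t := by positivity
    nlinarith

variable {V : Type*} [NormedAddCommGroup V] [InnerProductSpace ℝ V] [FiniteDimensional ℝ V]
  [MeasurableSpace V] [BorelSpace V]

lemma spaceWeight_le {s : ℝ} (hs : 0 < s) {x y : V} (h : ‖x - y‖ ≤ 1) :
    spaceWeight s y ≤ 2 ^ ((finrank ℝ V : ℝ) + s) * spaceWeight s x := by
  unfold spaceWeight
  have hxy : (1 + ‖x‖) / 2 ≤ 1 + ‖y‖ := by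
    have := norm_sub_norm_le x y
    have := norm_nonneg y
    linarith
  calc (1 + ‖y‖) ^ (-((finrank ℝ V : ℝ) + s)) ≤ ((1 + ‖x‖) / 2) ^ (-((finrank ℝ V : ℝ) + s)) :=
        Real.rpow_le_rpow_of_nonpos (by positivity) hxy (by
          have : 0 ≤ (finrank ℝ V : ℝ) + s := by positivity
          linarith)
    _ = _ := by
      rw [Real.div_rpow (by positivity) (by norm_num), Real.rpow_neg (by norm_num : (0:ℝ) ≤ 2)]
      field_simp

lemma abs_sub_le_of_hasDerivAt {f f' : ℝ → ℝ} (h : ∀ t, HasDerivAt f (f' t) t) {M : ℝ}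
    (hM : ∀ t, |f' t| ≤ M) (t r : ℝ) : |f t - f r| ≤ M * |t - r| := by
  have := Convex.norm_image_sub_le_of_norm_hasDerivWithin_le (s := univ) (x := r) (y := t)
    (fun t _ => (h t).hasDerivWithinAt) (fun t _ => hM t) convex_univ (mem_univ _) (mem_univ _)
  simpa using this

/-- Fractional quotients of a slab function with two slab time derivatives. -/
lemma exists_lintegral_slab_le {s β : ℝ} (hs : 0 < s) (hβ : 0 < β) (hβ1 : β < 1)
    {F F₁ F₂ : V → ℝ → ℝ} (hF : IsSlab s F) (hF₁ : IsSlab s F₁) (hF₂ : IsSlab s F₂)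
    (h1 : ∀ x t, HasDerivAt (F x) (F₁ x t) t) (h2 : ∀ x t, HasDerivAt (F₁ x) (F₂ x t) t) :
    ∃ C : ℝ, 0 < C ∧
      (∀ x t, ∫⁻ u, ‖fracQuot β (F x) t u‖ₑ ≤
        ENNReal.ofReal (C * (spaceWeight s x * timeWeight β t))) ∧
      ∀ x y t r, ‖x - y‖ ≤ 1 → |t - r| ≤ 1 →
        ∫⁻ u, ‖fracQuot β (F x) t u - fracQuot β (F y) r u‖ₑ ≤
          ENNReal.ofReal (C * (‖x - y‖ + |t - r|) * (spaceWeight s x * timeWeight β t)) := by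
  obtain ⟨K, hK, hfrac⟩ := exists_lintegral_fracQuot_le hβ hβ1
  obtain ⟨A, hA, a0, a1, a2⟩ := hF
  obtain ⟨A₁, hA₁, b0, b1, b2⟩ := hF₁
  obtain ⟨A₂, hA₂, c0, c1, c2⟩ := hF₂
  set Q : ℝ := 2 ^ ((finrank ℝ V : ℝ) + s)
  have hQ1 : 1 ≤ Q := Real.one_le_rpow (by norm_num) (by positivity)
  have hcont : ∀ x, Continuous (F x) := fun x =>
    continuous_iff_continuousAt.2 fun t => (h1 x t).continuousAt
  set B : ℝ := A + A₁ + A₂ with hB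
  have hB0 : 0 < B := by positivity
  -- The fractional estimate is stated for support in `[0, 9]` so that it also covers translates of
  -- `[1, 8]` by at most `1`.
  have hsub : ∀ t : ℝ, t ∉ Icc (0 : ℝ) 9 → t ∉ Icc (1 : ℝ) 8 := fun t ht h =>
    ht ⟨by linarith [h.1], by linarith [h.2]⟩
  refine ⟨K * (B * Q), by positivity, fun x t => ?_, fun x y t r hxy htr => ?_⟩
  · have hw := spaceWeight_pos s x
    have htw := timeWeight_pos β t
    refine (hfrac (F x) (B * spaceWeight s x) (by positivity) (fun t ht => a0 x t (hsub t ht))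
      (fun t => (a1 x t).trans ?_) ?_ t).trans (ENNReal.ofReal_le_ofReal ?_)
    · gcongr; rw [hB]; linarith
    · refine abs_sub_le_of_hasDerivAt (h1 x) fun t => (b1 x t).trans ?_
      gcongr; rw [hB]; linarith
    · calc _ = K * (B * 1) * (spaceWeight s x * timeWeight β t) := by ring
        _ ≤ _ := by gcongr
  · have hw := spaceWeight_pos s x
    have htw := timeWeight_pos β t
    have hwy := spaceWeight_le hs hxy
    have hwy0 := spaceWeight_pos s y
    -- The increment splits into a spatial one and a temporal one. The latter is written with a
    -- translation, so that both are fractional quotients at the same time `t`. The sup and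
    -- Lipschitz bounds of `g₂` come from `F₁` and `F₂` respectively, whence the two time
    -- derivatives.
    set g₁ : ℝ → ℝ := fun τ => F x τ - F y τ
    set g₂ : ℝ → ℝ := fun τ => F y τ - F y (τ + (r - t))
    have e : ∀ u, fracQuot β (F x) t u - fracQuot β (F y) r u =
        fracQuot β g₁ t u + fracQuot β g₂ t u := by
      intro u
      simp only [fracQuot, g₁, g₂]
      rw [show t + u + (r - t) = r + u by ring, show t + (r - t) = r by ring]
      ring
    have hg₁ : ∫⁻ u, ‖fracQuot β g₁ t u‖ₑ ≤
        ENNReal.ofReal (K * (B * ‖x - y‖ * spaceWeight s x) * timeWeight β t) := by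
      refine hfrac g₁ _ (by positivity) (fun t ht => ?_) (fun t => (a2 x y t hxy).trans ?_) ?_ t
      · simp [g₁, a0 _ t (hsub t ht)]
      · gcongr; rw [hB]; linarith
      · refine abs_sub_le_of_hasDerivAt (fun t => (h1 x t).sub (h1 y t)) fun t =>
          (b2 x y t hxy).trans ?_
        gcongr; rw [hB]; linarith
    have hg₂ : ∫⁻ u, ‖fracQuot β g₂ t u‖ₑ ≤
        ENNReal.ofReal (K * (B * |t - r| * spaceWeight s y) * timeWeight β t) := by
      have hshift : ∀ τ : ℝ, |τ - (τ + (r - t))| = |t - r| := fun τ => by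
        congr 1; ring
      have habs := abs_le.1 htr
      refine hfrac g₂ _ (by positivity) (fun τ hτ => ?_) (fun τ => ?_) ?_ t
      · simp only [g₂]
        rw [a0 _ τ (hsub τ hτ), a0, sub_zero]
        exact fun h => hτ ⟨by linarith [h.1], by linarith [h.2]⟩
      · have := abs_sub_le_of_hasDerivAt (h1 y) (b1 y) τ (τ + (r - t))
        rw [hshift] at this
        refine this.trans ?_
        rw [mul_right_comm]
        gcongr; rw [hB]; linarith
      · refine abs_sub_le_of_hasDerivAt (f' := fun τ => F₁ y τ - F₁ y (τ + (r - t)))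
          (fun τ => (h1 y τ).sub ((h1 y (τ + (r - t))).comp_add_const τ (r - t))) fun τ => ?_
        have := abs_sub_le_of_hasDerivAt (h2 y) (c1 y) τ (τ + (r - t))
        rw [hshift] at this
        refine this.trans ?_
        rw [mul_right_comm]
        gcongr; rw [hB]; linarith
    simp only [e]
    calc ∫⁻ u, ‖fracQuot β g₁ t u + fracQuot β g₂ t u‖ₑ
        ≤ ∫⁻ u, (‖fracQuot β g₁ t u‖ₑ + ‖fracQuot β g₂ t u‖ₑ) :=
          lintegral_mono fun u => enorm_add_le _ _
      _ = (∫⁻ u, ‖fracQuot β g₁ t u‖ₑ) + ∫⁻ u, ‖fracQuot β g₂ t u‖ₑ := by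
          refine lintegral_add_left ?_ _
          exact (measurable_fracQuot ((hcont x).sub (hcont y)) t).enorm
      _ ≤ _ := add_le_add hg₁ hg₂
      _ ≤ _ := by
          rw [← ENNReal.ofReal_add (by positivity) (by positivity)]
          refine ENNReal.ofReal_le_ofReal ?_
          calc _ ≤ K * (B * ‖x - y‖ * (Q * spaceWeight s x)) * timeWeight β t
                + K * (B * |t - r| * (Q * spaceWeight s x)) * timeWeight β t := by
                gcongr
                exact le_mul_of_one_le_left hw.le hQ1
            _ = _ := by ring

end Fractional

/-! ### The weight against measures of parabolic growth. -/

section Growth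

variable {n : ℕ}

/-- The space-time weight. -/
def weight (s β : ℝ) (p : SpaceTime n) : ℝ := spaceWeight s p.1 * timeWeight β p.2

lemma weight_pos (s β : ℝ) (p : SpaceTime n) : 0 < weight s β p :=
  mul_pos (spaceWeight_pos _ _) (timeWeight_pos _ _)

lemma continuous_weight (s β : ℝ) : Continuous (weight s β : SpaceTime n → ℝ) := by
  unfold weight spaceWeight timeWeight
  refine Continuous.mul ?_ ?_
  · exact Continuous.rpow_const (by fun_prop) fun p => Or.inl (by positivity)
  · exact Continuous.rpow_const (by fun_prop) fun p => Or.inl (by positivity)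

lemma weight_le_one {s β : ℝ} (hs : 0 < s) (hβ : 0 < β) (p : SpaceTime n) : weight s β p ≤ 1 := by
  unfold weight spaceWeight timeWeight
  refine mul_le_one₀ ?_ (by positivity) ?_
  · refine Real.rpow_le_one_of_one_le_of_nonpos (by linarith [norm_nonneg p.1]) ?_
    have : 0 ≤ (finrank ℝ (EuclideanSpace ℝ (Fin n)) : ℝ) + s := by positivity
    linarith
  · exact Real.rpow_le_one_of_one_le_of_nonpos (by linarith [abs_nonneg p.2]) (by linarith)

lemma integrable_weight {s β : ℝ} (hs : 0 < s) (hβ : 0 < β) :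
    Integrable (weight s β : SpaceTime n → ℝ) := by
  have h1 : Integrable (spaceWeight s : EuclideanSpace ℝ (Fin n) → ℝ) :=
    integrable_one_add_norm (by linarith)
  have h2 : Integrable (timeWeight β) := by
    have := integrable_one_add_norm (E := ℝ) (μ := volume) (r := 1 + β) (by simp; linarith)
    exact this
  exact h1.mul_prod h2

lemma pball_eq (s : ℝ) (p : SpaceTime n) (r : ℝ) :
    pball s p r = Metric.ball p.1 r ×ˢ Metric.ball p.2 ((2 * r) ^ (2 * s) / 2) := by
  ext q
  simp [pball, dist_eq_norm]

lemma isOpen_pball (s : ℝ) (p : SpaceTime n) (r : ℝ) : IsOpen (pball s p r) := by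
  rw [pball_eq]; exact Metric.isOpen_ball.prod Metric.isOpen_ball

lemma mem_pball_self (s : ℝ) (p : SpaceTime n) {r : ℝ} (hr : 0 < r) : p ∈ pball s p r := by
  simp only [pball, mem_ofPred_eq, sub_self, norm_zero, abs_zero]
  exact ⟨hr, by positivity⟩

lemma mem_pball_comm {s : ℝ} {p q : SpaceTime n} {r : ℝ} : p ∈ pball s q r ↔ q ∈ pball s p r := by
  simp only [pball, mem_ofPred_eq, norm_sub_rev p.1, abs_sub_comm p.2]

lemma isLocallyFiniteMeasure_of_pball {s B : ℝ} {μ : Measure (SpaceTime n)}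
    (h : ∀ p, μ (pball s p 1) ≤ ENNReal.ofReal B) : IsLocallyFiniteMeasure μ :=
  ⟨fun p => ⟨pball s p 1, (isOpen_pball s p 1).mem_nhds (mem_pball_self s p one_pos),
    (h p).trans_lt ENNReal.ofReal_lt_top⟩⟩

lemma HasGrowth.isLocallyFiniteMeasure {s ρ A : ℝ} {μ : Measure (SpaceTime n)}
    (h : HasGrowth s ρ A μ) : IsLocallyFiniteMeasure μ :=
  isLocallyFiniteMeasure_of_pball (s := s) (B := A) fun p => by simpa using h p 1 one_pos

/-- The weight varies slowly: within a unit parabolic ball the space variable moves by less than `1`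
and the time by at most `2 ^ (2 s) / 2 ≤ 2`. -/
lemma weight_le {s β : ℝ} (hs : 0 < s) (hs1 : s ≤ 1) (hβ : 0 < β) {p q : SpaceTime n}
    (h : p ∈ pball s q 1) : weight s β q ≤
      2 ^ ((finrank ℝ (EuclideanSpace ℝ (Fin n)) : ℝ) + s) * 3 ^ (1 + β) * weight s β p := by
  have h1 := spaceWeight_le hs (x := p.1) (y := q.1) h.1.le
  have h2 : timeWeight β q.2 ≤ 3 ^ (1 + β) * timeWeight β p.2 := by
    unfold timeWeight
    have h3 : |p.2 - q.2| ≤ 2 := by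
      refine h.2.le.trans ?_
      have : (2 * 1 : ℝ) ^ (2 * s) ≤ 2 ^ (2 : ℝ) := by
        rw [mul_one]; exact Real.rpow_le_rpow_of_exponent_le (by norm_num) (by linarith)
      rw [div_le_iff₀ (by norm_num)]
      exact this.trans (by norm_num)
    have h5 : (1 + |p.2|) / 3 ≤ 1 + |q.2| := by
      have := abs_sub_abs_le_abs_sub p.2 q.2
      have := abs_nonneg q.2
      linarith
    calc (1 + |q.2|) ^ (-(1 + β)) ≤ ((1 + |p.2|) / 3) ^ (-(1 + β)) :=
          Real.rpow_le_rpow_of_nonpos (by positivity) h5 (by linarith)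
      _ = _ := by
        rw [Real.div_rpow (by positivity) (by norm_num), Real.rpow_neg (by norm_num : (0:ℝ) ≤ 3)]
        field_simp
  have := spaceWeight_pos s q.1
  have := spaceWeight_pos s p.1
  have := timeWeight_pos β q.2
  calc weight s β q ≤ (2 ^ ((finrank ℝ (EuclideanSpace ℝ (Fin n)) : ℝ) + s) * spaceWeight s p.1)
        * (3 ^ (1 + β) * timeWeight β p.2) := by unfold weight; gcongr
    _ = _ := by unfold weight; ring

/-- The weight is integrable for measures with uniformly bounded mass on unit balls. -/
lemma exists_lintegral_weight_le {s β : ℝ} (hs : 0 < s) (hs1 : s ≤ 1) (hβ : 0 < β) :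
    ∃ C : ℝ, 0 < C ∧ ∀ (μ : Measure (SpaceTime n)) (B : ℝ), 0 ≤ B →
      (∀ p, μ (pball s p 1) ≤ ENNReal.ofReal B) →
      ∫⁻ q, ENNReal.ofReal (weight s β q) ∂μ ≤ ENNReal.ofReal (C * B) := by
  set Q : ℝ := 2 ^ ((finrank ℝ (EuclideanSpace ℝ (Fin n)) : ℝ) + s) * 3 ^ (1 + β)
  have hQ : 0 < Q := by positivity
  set W : ℝ := ∫ p : SpaceTime n, weight s β p
  have hW : 0 ≤ W := integral_nonneg fun p => (weight_pos s β p).le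
  set v : ℝ≥0∞ := volume (pball s (0 : SpaceTime n) 1)
  have hvol : ∀ p : SpaceTime n, volume (pball s p 1) = v := fun p => by
    simp only [v, pball_eq, Measure.volume_eq_prod, Measure.prod_prod]
    rw [Measure.addHaar_ball_center, Measure.addHaar_ball_center volume p.2]
    rfl
  have hv0 : v ≠ 0 := ((isOpen_pball s 0 1).measure_pos volume
    ⟨0, mem_pball_self s 0 one_pos⟩).ne'
  have hvt : v ≠ ⊤ := by
    simp only [v, pball_eq, Measure.volume_eq_prod, Measure.prod_prod]
    exact ENNReal.mul_ne_top measure_ball_lt_top.ne measure_ball_lt_top.ne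
  have hv : 0 < v.toReal := ENNReal.toReal_pos hv0 hvt
  refine ⟨Q * (W + 1) / v.toReal, by positivity, fun μ B hB h => ?_⟩
  have : IsLocallyFiniteMeasure μ := isLocallyFiniteMeasure_of_pball h
  set w : SpaceTime n → ℝ≥0∞ := fun p => ENNReal.ofReal (weight s β p)
  have hwm : Measurable w := (continuous_weight s β).measurable.ennreal_ofReal
  have hset : MeasurableSet {x : SpaceTime n × SpaceTime n | x.2 ∈ pball s x.1 1} := by
    refine IsOpen.measurableSet ?_
    simp only [pball, ofPred_and]
    exact (isOpen_lt (by fun_prop) continuous_const).inter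
      (isOpen_lt (by fun_prop) continuous_const)
  -- The weight at `q` is dominated by its Lebesgue average over the unit ball at `q`. All unit
  -- balls have the same volume `v`.
  have h1 : ∀ q, v * w q ≤ ENNReal.ofReal Q * ∫⁻ z, (pball s q 1).indicator w z := by
    intro q
    rw [lintegral_indicator (isOpen_pball s q 1).measurableSet, ← lintegral_const_mul _ hwm,
      ← hvol q, mul_comm, ← setLIntegral_const]
    refine setLIntegral_mono (hwm.const_mul _) fun z hz => ?_
    rw [← ENNReal.ofReal_mul hQ.le]
    exact ENNReal.ofReal_le_ofReal (weight_le hs hs1 hβ hz)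
  have hjm : Measurable (Function.uncurry fun (q z : SpaceTime n) => (pball s q 1).indicator w z) := by
    have : (Function.uncurry fun (q z : SpaceTime n) => (pball s q 1).indicator w z) =
        {x : SpaceTime n × SpaceTime n | x.2 ∈ pball s x.1 1}.indicator fun x => w x.2 := by
      ext x
      simp [Function.uncurry, indicator]
    rw [this]
    exact (hwm.comp measurable_snd).indicator hset
  -- Tonelli and the symmetry of `z ∈ pball s q 1` turn the average into `∫ μ (pball s z 1) w z dz`,
  -- so no covering argument is needed.
  have h2 : v * ∫⁻ q, w q ∂μ ≤ ENNReal.ofReal Q * (ENNReal.ofReal B * ENNReal.ofReal W) := by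
    calc v * ∫⁻ q, w q ∂μ = ∫⁻ q, v * w q ∂μ := (lintegral_const_mul _ hwm).symm
      _ ≤ ∫⁻ q, ENNReal.ofReal Q * (∫⁻ z, (pball s q 1).indicator w z) ∂μ := lintegral_mono h1
      _ = ENNReal.ofReal Q * ∫⁻ q, (∫⁻ z, (pball s q 1).indicator w z) ∂μ :=
          lintegral_const_mul' _ _ ENNReal.ofReal_ne_top
      _ = ENNReal.ofReal Q * ∫⁻ z, ∫⁻ q, (pball s q 1).indicator w z ∂μ := by
          rw [lintegral_lintegral_swap hjm.aemeasurable]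
      _ ≤ ENNReal.ofReal Q * ∫⁻ z, ENNReal.ofReal B * w z := by
          gcongr with z
          have e : ∀ q, (pball s q 1).indicator w z = (pball s z 1).indicator (fun _ => w z) q := by
            intro q
            by_cases hq : z ∈ pball s q 1
            · rw [indicator_of_mem hq, indicator_of_mem (mem_pball_comm.1 hq)]
            · rw [indicator_of_notMem hq, indicator_of_notMem fun h' => hq (mem_pball_comm.1 h')]
          simp only [e]
          rw [lintegral_indicator (isOpen_pball s z 1).measurableSet, setLIntegral_const, mul_comm]
          gcongr
          exact h z
      _ = _ := by
          rw [lintegral_const_mul _ hwm, ← ofReal_integral_eq_lintegral_ofReal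
            (integrable_weight hs hβ) (Filter.Eventually.of_forall fun p => (weight_pos s β p).le)]
  rw [mul_comm, ← ENNReal.le_div_iff_mul_le (Or.inl hv0) (Or.inl hvt)] at h2
  refine h2.trans ?_
  rw [← ENNReal.ofReal_mul hB, ← ENNReal.ofReal_mul hQ.le, ← ENNReal.ofReal_toReal hvt,
    ← ENNReal.ofReal_div_of_pos hv]
  refine ENNReal.ofReal_le_ofReal ?_
  rw [ENNReal.toReal_ofReal hv.le, div_mul_eq_mul_div]
  refine div_le_div_of_nonneg_right ?_ hv.le
  nlinarith [mul_nonneg hQ.le hB]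

/-- The parabolic dilation by `z⁻¹`. -/
def dil (s z : ℝ) (p : SpaceTime n) : SpaceTime n := (z⁻¹ • p.1, (z ^ (2 * s))⁻¹ * p.2)

lemma continuous_dil (s z : ℝ) : Continuous (dil s z : SpaceTime n → SpaceTime n) := by
  unfold dil; fun_prop

/-- The image of `μ` under `q ↦ dil s z (p - q)` gives a unit ball at most the `μ`-mass of a
parabolic ball of radius `z`, namely `A z ^ ρ`; the unit-scale estimate applies to this image. -/
lemma exists_lintegral_weight_dil_le {s β : ℝ} (hs : 0 < s) (hs1 : s ≤ 1) (hβ : 0 < β) :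
    ∃ C : ℝ, 0 < C ∧ ∀ (μ : Measure (SpaceTime n)) (ρ A : ℝ), 0 ≤ A → HasGrowth s ρ A μ →
      ∀ (p : SpaceTime n) (z : ℝ), 0 < z →
      ∫⁻ q, ENNReal.ofReal (weight s β (dil s z (p - q))) ∂μ ≤ ENNReal.ofReal (C * (A * z ^ ρ)) := by
  obtain ⟨C, hC, h⟩ := exists_lintegral_weight_le (n := n) hs hs1 hβ
  refine ⟨C, hC, fun μ ρ A hA hμ p z hz => ?_⟩
  have hmeas : Measurable fun q : SpaceTime n => dil s z (p - q) :=
    ((continuous_dil s z).comp (continuous_const.sub continuous_id)).measurable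
  have := h (μ.map fun q => dil s z (p - q)) (A * z ^ ρ) (by positivity) fun y => by
    rw [Measure.map_apply hmeas (isOpen_pball s y 1).measurableSet]
    refine (measure_mono ?_).trans (hμ (p.1 - z • y.1, p.2 - z ^ (2 * s) * y.2) z hz)
    rintro q ⟨h1, h2⟩
    have hz2 : 0 < z ^ (2 * s) := by positivity
    constructor
    · simp only [dil, Prod.fst_sub] at h1
      have e : q.1 - (p.1 - z • y.1) = -(z • (z⁻¹ • (p.1 - q.1) - y.1)) := by
        rw [smul_sub, smul_inv_smul₀ hz.ne']; abel
      rw [e, norm_neg, norm_smul, Real.norm_of_nonneg hz.le]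
      nlinarith
    · simp only [dil, Prod.snd_sub] at h2
      have e : q.2 - (p.2 - z ^ (2 * s) * y.2) =
          -(z ^ (2 * s) * ((z ^ (2 * s))⁻¹ * (p.2 - q.2) - y.2)) := by
        field_simp; ring
      rw [e, abs_neg, abs_mul, abs_of_pos hz2, mul_comm 2 z, Real.mul_rpow hz.le (by norm_num),
        mul_div_assoc]
      simp only [mul_one] at h2
      gcongr
  rwa [lintegral_map (continuous_weight s β).measurable.ennreal_ofReal hmeas] at this

end Growth

/-! ### Dyadic decomposition of the kernel in time. -/

section Pieces

variable {n : ℕ}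

lemma P_eq (s : ℝ) (p : SpaceTime n) : P s p = if 0 < p.2 then profile s 0 p.2 p.1 else 0 := by
  unfold P profile symbol
  simp only [pow_zero, one_mul]

lemma measurable_profile {V : Type*} [NormedAddCommGroup V] [InnerProductSpace ℝ V]
    [FiniteDimensional ℝ V] [MeasurableSpace V] [BorelSpace V] {s : ℝ} (hs : 0 < s) (j : ℕ) :
    Measurable fun p : V × ℝ => profile s j p.2 p.1 := by
  have h : Continuous fun x : (V × ℝ) × V =>
      Complex.exp (↑(2 * Real.pi * inner ℝ x.2 x.1.1) * Complex.I) •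
        ((symbol s j x.1.2 x.2 : ℝ) : ℂ) := by
    unfold symbol
    have : Continuous fun x : (V × ℝ) × V => ‖x.2‖ ^ (2 * s) :=
      (by fun_prop : Continuous fun x : (V × ℝ) × V => ‖x.2‖).rpow_const
        fun _ => Or.inr (by positivity)
    fun_prop
  have h2 := h.stronglyMeasurable.integral_prod_right' (ν := (volume : Measure V))
  have h3 := Complex.measurable_re.comp h2.measurable
  convert h3 using 2 with p
  simp [profile, Real.fourierInv_eq']

lemma measurable_P {s : ℝ} (hs : 0 < s) : Measurable (P s : SpaceTime n → ℝ) := by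
  have : (P s : SpaceTime n → ℝ) = fun p => if 0 < p.2 then profile s 0 p.2 p.1 else 0 :=
    funext (P_eq s)
  rw [this]
  exact Measurable.ite (measurableSet_lt measurable_const measurable_snd)
    (measurable_profile hs 0) measurable_const

/-- The smooth time step. -/
def timeStep (t : ℝ) : ℝ := Real.smoothTransition (t - 1)

lemma timeStep_eq_zero {t : ℝ} (h : t ≤ 1) : timeStep t = 0 :=
  Real.smoothTransition.zero_of_nonpos (by linarith)

lemma timeStep_eq_one {t : ℝ} (h : 2 ≤ t) : timeStep t = 1 :=
  Real.smoothTransition.one_of_one_le (by linarith)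

lemma contDiff_timeStep : ContDiff ℝ ∞ timeStep :=
  Real.smoothTransition.contDiff.comp (contDiff_id.sub contDiff_const)

/-- The function generating the dyadic partition of unity in time. -/
def timeBump (s t : ℝ) : ℝ := timeStep t - timeStep (t / 2 ^ (2 * s))

/-- The two steps differ only for `1 ≤ t ≤ 2 · 2 ^ (2 s)`, and `s ≤ 1` makes the upper end at most
`8`; this is the origin of the slab `[1, 8]`. -/
lemma isTimeCutoff_timeBump {s : ℝ} (hs : 0 < s) (hs1 : s ≤ 1) : IsTimeCutoff (timeBump s) := by
  refine ⟨contDiff_timeStep.sub (contDiff_timeStep.comp (contDiff_id.div_const _)), fun t ht => ?_⟩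
  have h1 : (1 : ℝ) ≤ 2 ^ (2 * s) := Real.one_le_rpow (by norm_num) (by positivity)
  have h4 : (2 : ℝ) ^ (2 * s) ≤ 4 := by
    calc (2 : ℝ) ^ (2 * s) ≤ 2 ^ (2 : ℝ) :=
          Real.rpow_le_rpow_of_exponent_le (by norm_num) (by linarith)
      _ = 4 := by norm_num
  rw [mem_Icc, not_and_or, not_le, not_le] at ht
  unfold timeBump
  rcases ht with ht | ht
  · rw [timeStep_eq_zero ht.le, timeStep_eq_zero, sub_zero]
    rw [div_le_one (by positivity)]; linarith
  · rw [timeStep_eq_one (by linarith), timeStep_eq_one, sub_self]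
    rw [le_div_iff₀ (by positivity)]; linarith

/-- Dividing the time by `2 ^ (2 s)` amounts to replacing `k` by `k + 1`, so the sum telescopes; for
fixed `t > 0` only finitely many terms are nonzero. -/
lemma hasSum_timeBump {s : ℝ} (hs : 0 < s) {t : ℝ} (ht : 0 < t) :
    HasSum (fun k : ℤ => timeBump s ((((2 : ℝ) ^ k) ^ (2 * s))⁻¹ * t)) 1 := by
  have hmono : ∀ {a b : ℝ}, 0 < a → 0 < b → b ^ (1 / (2 * s)) ≤ a → b ≤ a ^ (2 * s) := by
    intro a b ha hb h
    have := Real.rpow_le_rpow (by positivity) h (show 0 ≤ 2 * s by positivity)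
    rwa [← Real.rpow_mul hb.le, one_div_mul_cancel (by positivity), Real.rpow_one] at this
  have hmono' : ∀ {a b : ℝ}, 0 < a → 0 < b → a ≤ b ^ (1 / (2 * s)) → a ^ (2 * s) ≤ b := by
    intro a b ha hb h
    have := Real.rpow_le_rpow (by positivity) h (show 0 ≤ 2 * s by positivity)
    rwa [← Real.rpow_mul hb.le, one_div_mul_cancel (by positivity), Real.rpow_one] at this
  obtain ⟨K₁, -, h1⟩ := exists_zpow_bounds (x := (t ^ (1 / (2 * s)))⁻¹) (by positivity)
  obtain ⟨K₂, h2, -⟩ := exists_zpow_bounds (x := ((t / 2) ^ (1 / (2 * s)))⁻¹) (by positivity)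
  convert hasSum_int_telescope (f := fun k : ℤ => timeStep ((((2 : ℝ) ^ k) ^ (2 * s))⁻¹ * t))
    (A := 1) (K := max K₁ K₂) (fun k hk => ?_) (fun k hk => ?_) using 2 with k
  · unfold timeBump
    congr 2
    rw [zpow_add_one₀ (by norm_num), Real.mul_rpow (by positivity) (by norm_num)]
    field_simp
  · refine timeStep_eq_one ?_
    have hk2 : ((2 : ℝ) ^ k) ^ (2 * s) ≤ t / 2 := by
      refine hmono' (by positivity) (by positivity) ?_
      have := h2 k (by push_cast at hk; omega)
      rwa [← div_eq_mul_inv, div_le_one (by positivity)] at this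
    rw [inv_mul_eq_div, le_div_iff₀ (by positivity)]
    linarith
  · refine timeStep_eq_zero ?_
    have hk2 : t ≤ ((2 : ℝ) ^ k) ^ (2 * s) := by
      refine hmono (by positivity) ht ?_
      have := h1 k (by push_cast at hk; omega)
      rw [← div_eq_mul_inv, le_div_iff₀ (by positivity)] at this
      have : 0 < t ^ (1 / (2 * s)) := by positivity
      linarith
    rw [inv_mul_eq_div]
    exact (div_le_one (by positivity)).2 hk2

/-- The localized kernel at unit scale. -/
def slab (s : ℝ) (x : EuclideanSpace ℝ (Fin n)) (t : ℝ) : ℝ := timeBump s t * profile s 0 t x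

/-- The localized kernel at scale `z`. -/
def piece (s z : ℝ) (p : SpaceTime n) : ℝ :=
  z ^ (-(n : ℝ)) * slab s (dil s z p).1 (dil s z p).2

lemma measurable_slab {s : ℝ} (hs : 0 < s) :
    Measurable fun p : SpaceTime n => slab s p.1 p.2 := by
  refine Measurable.mul ?_ (measurable_profile hs 0)
  have : Continuous (timeBump s) :=
    contDiff_timeStep.continuous.sub (contDiff_timeStep.continuous.comp (by fun_prop))
  exact this.measurable.comp measurable_snd

lemma measurable_piece {s : ℝ} (hs : 0 < s) (z : ℝ) : Measurable (piece s z : SpaceTime n → ℝ) :=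
  ((measurable_slab hs).comp (continuous_dil s z).measurable).const_mul _

lemma piece_eq {s : ℝ} (hs : 0 < s) (hs1 : s ≤ 1) {z : ℝ} (hz : 0 < z) (p : SpaceTime n) :
    piece s z p = timeBump s ((z ^ (2 * s))⁻¹ * p.2) * P s p := by
  have hz2 : 0 < z ^ (2 * s) := by positivity
  rw [P_eq]
  unfold piece slab dil
  split_ifs with hp
  · have h := profile_scaling (s := s) 0 ((z ^ (2 * s))⁻¹ * p.2) hz p.1
    rw [mul_inv_cancel_left₀ hz2.ne'] at h
    rw [h, finrank_euclideanSpace_fin]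
    simp only [Nat.cast_zero, mul_zero, add_zero]
    ring
  · have : timeBump s ((z ^ (2 * s))⁻¹ * p.2) = 0 := by
      refine (isTimeCutoff_timeBump hs hs1).2 _ fun h => ?_
      have := h.1
      rw [inv_mul_eq_div, one_le_div hz2] at this
      linarith
    rw [this]; simp

lemma hasSum_piece {s : ℝ} (hs : 0 < s) (hs1 : s ≤ 1) (p : SpaceTime n) :
    HasSum (fun k : ℤ => piece s ((2 : ℝ) ^ k) p) (P s p) := by
  have e : ∀ k : ℤ, piece s ((2 : ℝ) ^ k) p =
      timeBump s ((((2 : ℝ) ^ k) ^ (2 * s))⁻¹ * p.2) * P s p := fun k =>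
    piece_eq hs hs1 (by positivity) p
  simp only [e]
  by_cases hp : 0 < p.2
  · simpa using (hasSum_timeBump hs hp).mul_right (P s p)
  · have : P s p = 0 := by simp [P, hp]
    simp [this]

/-- The difference quotient of the fractional time derivative, centred at the base point. -/
def shiftQuot (β : ℝ) (f : SpaceTime n → ℝ) (p : SpaceTime n) (u : ℝ) : ℝ :=
  (f (p.1, p.2 + u) - f p) / |u| ^ (1 + β)

lemma timeQuotient_eq (β : ℝ) (f : SpaceTime n → ℝ) (p : SpaceTime n) (τ : ℝ) :
    timeQuotient β f p τ = shiftQuot β f p (τ - p.2) := by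
  simp [timeQuotient, shiftQuot]

lemma timeDeriv_eq (β : ℝ) (f : SpaceTime n → ℝ) (p : SpaceTime n) :
    timeDeriv β f p = ∫ u, shiftQuot β f p u := by
  simp only [timeDeriv, timeQuotient_eq]
  exact integral_sub_right_eq_self (fun u => shiftQuot β f p u) p.2

lemma measurable_shiftQuot (β : ℝ) {f : SpaceTime n → ℝ} (hf : Measurable f) :
    Measurable fun x : SpaceTime n × ℝ => shiftQuot β f x.1 x.2 := by
  unfold shiftQuot
  fun_prop

/-- The factor `z ^ (-n)` comes from the kernel and `z ^ (-2 s (1 + β))` from the denominator.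
Integration in `u` later returns `z ^ (2 s)`, leaving the order `-(n + 2 s β)`. -/
lemma shiftQuot_piece {s : ℝ} (β : ℝ) {z : ℝ} (hz : 0 < z) (p : SpaceTime n) (u : ℝ) :
    shiftQuot β (piece s z) p u = z ^ (-((n : ℝ) + 2 * s * (1 + β))) *
      fracQuot β (slab s (dil s z p).1) (dil s z p).2 ((z ^ (2 * s))⁻¹ * u) := by
  have hz2 : 0 < z ^ (2 * s) := by positivity
  have e : z ^ (-((n : ℝ) + 2 * s * (1 + β))) =
      z ^ (-(n : ℝ)) * ((z ^ (2 * s))⁻¹) ^ (1 + β) := by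
    rw [Real.inv_rpow hz2.le, ← Real.rpow_mul hz.le, ← Real.rpow_neg hz.le, ← Real.rpow_add hz]
    congr 1; ring
  unfold shiftQuot fracQuot piece
  rw [e, abs_mul, abs_of_pos (inv_pos.2 hz2), Real.mul_rpow (by positivity) (abs_nonneg _)]
  simp only [dil]
  have hne : ((z ^ (2 * s))⁻¹) ^ (1 + β) ≠ 0 := by positivity
  rw [mul_add, ← mul_sub, mul_div_assoc, mul_assoc, ← mul_div_mul_left _ _ hne]
  ring

lemma lintegral_comp_mul_left' {c : ℝ} (hc : 0 < c) (g : ℝ → ℝ≥0∞) :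
    ∫⁻ u, g (c * u) = ENNReal.ofReal c⁻¹ * ∫⁻ u, g u := by
  have h := (Homeomorph.mulLeft₀ c hc.ne').measurableEmbedding.lintegral_map
    (μ := (volume : Measure ℝ)) g
  simp only [Homeomorph.coe_mulLeft₀] at h
  rw [← h, Real.map_volume_mul_left hc.ne', lintegral_smul_measure, abs_of_pos (inv_pos.2 hc),
    smul_eq_mul]

/-- Bounds for the fractional quotients of the localized kernels at unit scale. -/
lemma exists_slab_bound [Nontrivial (EuclideanSpace ℝ (Fin n))] {s β : ℝ} (hs : 0 < s)
    (hs1 : s ≤ 1) (hβ : 0 < β) (hβ1 : β < 1) : ∃ C : ℝ, 0 < C ∧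
      (∀ p : SpaceTime n, |slab s p.1 p.2| ≤ C * weight s β p) ∧
      (∀ p : SpaceTime n, ∫⁻ u, ‖fracQuot β (slab s p.1) p.2 u‖ₑ ≤
        ENNReal.ofReal (C * weight s β p)) ∧
      ∀ p q : SpaceTime n, ‖p.1 - q.1‖ ≤ 1 → |p.2 - q.2| ≤ 1 →
        ∫⁻ u, ‖fracQuot β (slab s p.1) p.2 u - fracQuot β (slab s q.1) q.2 u‖ₑ ≤
          ENNReal.ofReal (C * (‖p.1 - q.1‖ + |p.2 - q.2|) * weight s β p) := by
  have hcut := isTimeCutoff_timeBump hs hs1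
  have hslab := hcut.isSlab (V := EuclideanSpace ℝ (Fin n)) hs hs1 0
  obtain ⟨F₁, F₂, h1, h2, hd1, hd2⟩ :=
    hcut.exists_derivs (V := EuclideanSpace ℝ (Fin n)) hs hs1
  obtain ⟨C, hC, hA, hB⟩ := exists_lintegral_slab_le hs hβ hβ1 hslab h1 h2 hd1 hd2
  obtain ⟨A, hA0, a0, a1, -⟩ := hslab
  refine ⟨C + A * 9 ^ (1 + β), by positivity, fun p => ?_, fun p => ?_, fun p q h1 h2 => ?_⟩
  · have hw := spaceWeight_pos s p.1
    have htw := timeWeight_pos β p.2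
    have hww := weight_pos s β p
    by_cases hp : p.2 ∈ Icc (1 : ℝ) 8
    -- On `1 ≤ t ≤ 8` the temporal weight is at least `9 ^ (-(1 + β))`, so it can be inserted at the
    -- cost of a constant.
    · have h9 : 1 ≤ 9 ^ (1 + β) * timeWeight β p.2 := by
        unfold timeWeight
        rw [Real.rpow_neg (by positivity), ← div_eq_mul_inv, one_le_div (by positivity)]
        refine Real.rpow_le_rpow (by positivity) ?_ (by linarith)
        rw [abs_of_nonneg (by linarith [hp.1])]
        linarith [hp.2]
      calc _ ≤ A * spaceWeight s p.1 := a1 p.1 p.2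
        _ ≤ A * spaceWeight s p.1 * (9 ^ (1 + β) * timeWeight β p.2) :=
          le_mul_of_one_le_right (by positivity) h9
        _ = A * 9 ^ (1 + β) * weight s β p := by unfold weight; ring
        _ ≤ _ := by gcongr; linarith
    · have : slab s p.1 p.2 = 0 := a0 p.1 p.2 hp
      rw [this, abs_zero]; positivity
  · refine (hA p.1 p.2).trans (ENNReal.ofReal_le_ofReal ?_)
    have hww := weight_pos s β p
    change C * weight s β p ≤ _
    gcongr
    have : 0 < A * 9 ^ (1 + β) := by positivity
    linarith
  · refine (hB p.1 q.1 p.2 q.2 h1 h2).trans (ENNReal.ofReal_le_ofReal ?_)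
    have hww := weight_pos s β p
    change C * _ * weight s β p ≤ _
    gcongr
    have : 0 < A * 9 ^ (1 + β) := by positivity
    linarith

lemma rpow_scale_eq {n : ℕ} {s β z : ℝ} (hz : 0 < z) :
    z ^ (-((n : ℝ) + 2 * s * (1 + β))) * z ^ (2 * s) = z ^ (-((n : ℝ) + 2 * s * β)) := by
  rw [← Real.rpow_add hz]; congr 1; ring

/-- Bounds for the localized kernels at scale `z` and their fractional quotients. -/
lemma exists_piece_bound [Nontrivial (EuclideanSpace ℝ (Fin n))] {s β : ℝ} (hs : 0 < s)
    (hs1 : s ≤ 1) (hβ : 0 < β) (hβ1 : β < 1) : ∃ C : ℝ, 0 < C ∧ ∀ z : ℝ, 0 < z →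
      (∀ p : SpaceTime n, ‖piece s z p‖ₑ ≤
        ENNReal.ofReal (C * z ^ (-(n : ℝ))) * ENNReal.ofReal (weight s β (dil s z p))) ∧
      (∀ p : SpaceTime n, ∫⁻ u, ‖shiftQuot β (piece s z) p u‖ₑ ≤
        ENNReal.ofReal (C * z ^ (-((n : ℝ) + 2 * s * β))) *
          ENNReal.ofReal (weight s β (dil s z p))) ∧
      ∀ p q : SpaceTime n, ‖p.1 - q.1‖ ≤ z → |p.2 - q.2| ≤ z ^ (2 * s) →
        ∫⁻ u, ‖shiftQuot β (piece s z) p u - shiftQuot β (piece s z) q u‖ₑ ≤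
          ENNReal.ofReal (C * z ^ (-((n : ℝ) + 2 * s * β)) *
            (‖p.1 - q.1‖ / z + |p.2 - q.2| / z ^ (2 * s))) *
          ENNReal.ofReal (weight s β (dil s z p)) := by
  obtain ⟨C, hC, h0, h1, h2⟩ := exists_slab_bound (n := n) hs hs1 hβ hβ1
  refine ⟨C, hC, fun z hz => ?_⟩
  have hz2 : 0 < z ^ (2 * s) := by positivity
  have hscale : ∀ g : ℝ → ℝ, ∫⁻ u, ‖z ^ (-((n : ℝ) + 2 * s * (1 + β))) *
      g ((z ^ (2 * s))⁻¹ * u)‖ₑ = ENNReal.ofReal (z ^ (-((n : ℝ) + 2 * s * β))) * ∫⁻ u, ‖g u‖ₑ := by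
    intro g
    simp only [enorm_mul]
    rw [lintegral_const_mul' _ _ enorm_ne_top,
      lintegral_comp_mul_left' (inv_pos.2 hz2) (fun u => ‖g u‖ₑ), inv_inv,
      Real.enorm_eq_ofReal_abs, abs_of_pos (by positivity), ← mul_assoc,
      ← ENNReal.ofReal_mul (by positivity), rpow_scale_eq hz]
  refine ⟨fun p => ?_, fun p => ?_, fun p q hx ht => ?_⟩
  · have hw := weight_pos s β (dil s z p)
    rw [← ENNReal.ofReal_mul (by positivity), Real.enorm_eq_ofReal_abs]
    refine ENNReal.ofReal_le_ofReal ?_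
    unfold piece
    rw [abs_mul, abs_of_pos (show 0 < z ^ (-(n : ℝ)) by positivity), mul_comm C, mul_assoc]
    gcongr
    exact h0 _
  · simp only [shiftQuot_piece β hz]
    rw [hscale]
    refine (mul_le_mul_right (h1 (dil s z p)) _).trans_eq ?_
    rw [← ENNReal.ofReal_mul (by positivity), ← ENNReal.ofReal_mul (by positivity)]
    congr 1
    ring
  · simp only [shiftQuot_piece β hz, ← mul_sub]
    rw [hscale (fun u => fracQuot β (slab s (dil s z p).1) (dil s z p).2 u -
      fracQuot β (slab s (dil s z q).1) (dil s z q).2 u)]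
    have hw := weight_pos s β (dil s z p)
    have e1 : ‖(dil s z p).1 - (dil s z q).1‖ = ‖p.1 - q.1‖ / z := by
      simp only [dil]
      rw [← smul_sub, norm_smul, norm_inv, Real.norm_of_nonneg hz.le, inv_mul_eq_div]
    have e2 : |(dil s z p).2 - (dil s z q).2| = |p.2 - q.2| / z ^ (2 * s) := by
      simp only [dil]
      rw [← mul_sub, abs_mul, abs_of_pos (inv_pos.2 hz2), inv_mul_eq_div]
    have h3 := h2 (dil s z p) (dil s z q) (by rw [e1]; exact (div_le_one hz).2 hx)
      (by rw [e2]; exact (div_le_one hz2).2 ht)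
    rw [e1, e2] at h3
    refine (mul_le_mul_right h3 _).trans_eq ?_
    rw [← ENNReal.ofReal_mul (by positivity), ← ENNReal.ofReal_mul (by positivity)]
    congr 1
    ring

end Pieces

/-! ### Summation over dyadic scales. -/

section Sums

lemma two_rpow_neg_lt_one {a : ℝ} (ha : 0 < a) : (2 : ℝ) ^ (-a) < 1 :=
  Real.rpow_lt_one_of_one_lt_of_neg (by norm_num) (by linarith)

lemma tsum_ofReal_pow_natAbs {r : ℝ} (h0 : 0 ≤ r) (h1 : r < 1) :
    ∑' k : ℤ, ENNReal.ofReal (r ^ k.natAbs) = ENNReal.ofReal (∑' k : ℤ, r ^ k.natAbs) :=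
  (ENNReal.ofReal_tsum_of_nonneg (fun k => by positivity) (summable_pow_natAbs h0 h1)).symm

/-- The first bound is geometric over `k ≤ 0` and the second over `k ≥ 0`. -/
lemma tsum_min_zpow_lt_top {a b : ℝ} (ha : 0 < a) (hb : 0 < b) {X Y : ℝ≥0∞} (hX : X ≠ ⊤)
    (hY : Y ≠ ⊤) : ∑' k : ℤ, min (X * ENNReal.ofReal (((2 : ℝ) ^ k) ^ a))
      (Y * ENNReal.ofReal (((2 : ℝ) ^ k) ^ (-b))) < ⊤ := by
  set r : ℝ := max (2 ^ (-a)) (2 ^ (-b))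
  have hr0 : 0 ≤ r := le_max_of_le_left (by positivity)
  have hr1 : r < 1 := max_lt (two_rpow_neg_lt_one ha) (two_rpow_neg_lt_one hb)
  have hle : ∀ k : ℤ, min (X * ENNReal.ofReal (((2 : ℝ) ^ k) ^ a))
      (Y * ENNReal.ofReal (((2 : ℝ) ^ k) ^ (-b))) ≤ (X + Y) * ENNReal.ofReal (r ^ k.natAbs) := by
    intro k
    rcases le_total k 0 with hk | hk
    · refine (min_le_left _ _).trans (mul_le_mul' le_self_add (ENNReal.ofReal_le_ofReal ?_))
      rw [two_zpow_rpow hk]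
      exact pow_le_pow_left₀ (by positivity) (le_max_left _ _) _
    · refine (min_le_right _ _).trans (mul_le_mul' le_add_self (ENNReal.ofReal_le_ofReal ?_))
      rw [two_zpow_rpow_neg hk]
      exact pow_le_pow_left₀ (by positivity) (le_max_right _ _) _
  refine (ENNReal.tsum_le_tsum hle).trans_lt ?_
  rw [ENNReal.tsum_mul_left, tsum_ofReal_pow_natAbs hr0 hr1]
  exact ENNReal.mul_lt_top (ENNReal.add_lt_top.2 ⟨hX.lt_top, hY.lt_top⟩) ENNReal.ofReal_lt_top

/-- Summation of dyadic contributions to a Hölder estimate. -/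
lemma exists_tsum_dyadic_le {s α : ℝ} (hα : 0 < α) (hα1 : α < min 1 (2 * s)) :
    ∃ S : ℝ, 0 < S ∧ ∀ (X : ℝ≥0∞) (T : ℤ → ℝ≥0∞) (ρ : ℝ), 0 < ρ →
      (∀ k, T k ≤ X * ENNReal.ofReal (2 * ((2 : ℝ) ^ k) ^ α)) →
      (∀ k, ρ ≤ (2 : ℝ) ^ k → T k ≤ X * ENNReal.ofReal
        (((2 : ℝ) ^ k) ^ α * (ρ / 2 ^ k + (ρ / 2 ^ k) ^ (2 * s)))) →
      ∑' k, T k ≤ X * ENNReal.ofReal (S * ρ ^ α) := by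
  set θ : ℝ := min 1 (2 * s)
  set γ : ℝ := θ - α
  have hγ : 0 < γ := sub_pos.2 hα1
  have hγ1 : γ ≤ 1 := by have : θ ≤ 1 := min_le_left _ _
                         simp only [γ]; linarith
  set r : ℝ := max (2 ^ (-α)) (2 ^ (-γ))
  have hr0 : 0 ≤ r := le_max_of_le_left (by positivity)
  have hr1 : r < 1 := max_lt (two_rpow_neg_lt_one hα) (two_rpow_neg_lt_one hγ)
  set R := ∑' k : ℤ, r ^ k.natAbs
  have hR : 0 ≤ R := tsum_nonneg fun k => by positivity
  refine ⟨4 * R + 1, by positivity, fun X T ρ hρ h1 h2 => ?_⟩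
  -- The critical scale: `2 ^ k₀ ≤ ρ < 2 ^ (k₀ + 1)`. The first bound is used for `k ≤ k₀`, the
  -- second for `k > k₀`, where `ρ ≤ 2 ^ k` does hold.
  obtain ⟨k₀, hk₀, hk₁⟩ := exists_mem_Ico_zpow hρ (show (1 : ℝ) < 2 by norm_num)
  have hle : ∀ k, T k ≤ X * ENNReal.ofReal (4 * ρ ^ α) * ENNReal.ofReal (r ^ (k - k₀).natAbs) := by
    intro k
    rw [mul_assoc, ← ENNReal.ofReal_mul (by positivity)]
    set z : ℝ := 2 ^ k
    have hz : 0 < z := by positivity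
    have hzk : z = 2 ^ (k - k₀) * 2 ^ k₀ := by
      rw [← zpow_add₀ (by norm_num), sub_add_cancel]
    rcases le_or_gt k k₀ with hk | hk
    · refine (h1 k).trans (mul_le_mul' le_rfl (ENNReal.ofReal_le_ofReal ?_))
      calc 2 * z ^ α ≤ 2 * (2 ^ (k - k₀) * ρ) ^ α := by rw [hzk]; gcongr
        _ = 2 * ρ ^ α * ((2 : ℝ) ^ (-α)) ^ (k - k₀).natAbs := by
            rw [Real.mul_rpow (by positivity) hρ.le, two_zpow_rpow (by omega)]; ring
        _ ≤ 4 * ρ ^ α * r ^ (k - k₀).natAbs := by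
            gcongr
            · norm_num
            · exact le_max_left _ _
    · have hz1 : (2 : ℝ) ^ (k₀ + 1) ≤ z := zpow_le_zpow_right₀ (by norm_num) (by omega)
      refine (h2 k (hk₁.le.trans hz1)).trans (mul_le_mul' le_rfl (ENNReal.ofReal_le_ofReal ?_))
      -- Since `x ≤ 1`, both `x` and `x ^ (2 s)` are at most `x ^ θ`. With `z ^ α = ρ ^ α x ^ (-α)`
      -- there remains `x ^ γ`, where `γ = θ - α > 0`, which decays geometrically in `k - k₀`.
      set x := ρ / z
      have hx : 0 < x := by positivity
      have hx1 : x ≤ 1 := (div_le_one hz).2 (hk₁.le.trans hz1)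
      have hzx : z = ρ / x := by simp only [x]; field_simp
      have e1 : x ≤ x ^ θ := by
        conv_lhs => rw [← Real.rpow_one x]
        exact Real.rpow_le_rpow_of_exponent_ge hx hx1 (min_le_left _ _)
      have e2 : x ^ (2 * s) ≤ x ^ θ := Real.rpow_le_rpow_of_exponent_ge hx hx1 (min_le_right _ _)
      have e3 : x ≤ 2 * (2 ^ (k - k₀))⁻¹ := by
        simp only [x]
        rw [hzk, ← div_eq_mul_inv, div_le_div_iff₀ (by positivity) (by positivity)]
        rw [zpow_add_one₀ (by norm_num)] at hk₁
        have : (0 : ℝ) < 2 ^ (k - k₀) := by positivity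
        nlinarith
      have e4 : x ^ γ ≤ 2 * ((2 : ℝ) ^ (-γ)) ^ (k - k₀).natAbs := by
        calc x ^ γ ≤ (2 * (2 ^ (k - k₀))⁻¹) ^ γ := by gcongr
          _ = 2 ^ γ * ((2 : ℝ) ^ (k - k₀)) ^ (-γ) := by
            rw [Real.mul_rpow (by norm_num) (by positivity), Real.inv_rpow (by positivity),
              Real.rpow_neg (by positivity)]
          _ ≤ 2 ^ (1 : ℝ) * ((2 : ℝ) ^ (k - k₀)) ^ (-γ) := by
            gcongr
            norm_num
          _ = _ := by rw [two_zpow_rpow_neg (by omega), Real.rpow_one]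
      calc z ^ α * (x + x ^ (2 * s)) ≤ z ^ α * (x ^ θ + x ^ θ) := by gcongr
        _ = 2 * ρ ^ α * x ^ γ := by
            rw [hzx, Real.div_rpow hρ.le hx.le, show θ = γ + α by simp [γ], Real.rpow_add hx]
            field_simp
            ring
        _ ≤ 2 * ρ ^ α * (2 * ((2 : ℝ) ^ (-γ)) ^ (k - k₀).natAbs) := by gcongr
        _ ≤ 2 * ρ ^ α * (2 * r ^ (k - k₀).natAbs) := by
            gcongr
            exact le_max_right _ _
        _ = _ := by ring
  refine (ENNReal.tsum_le_tsum hle).trans ?_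
  have e := (Equiv.subRight k₀).tsum_eq fun k : ℤ => ENNReal.ofReal (r ^ k.natAbs)
  simp only [Equiv.subRight_apply] at e
  rw [ENNReal.tsum_mul_left, e, tsum_ofReal_pow_natAbs hr0 hr1, mul_assoc,
    ← ENNReal.ofReal_mul (by positivity)]
  refine mul_le_mul' le_rfl (ENNReal.ofReal_le_ofReal ?_)
  have : 0 < ρ ^ α := by positivity
  change 4 * ρ ^ α * R ≤ _
  nlinarith

end Sums

/-! ### Contribution of one scale to the potentials. -/

section Potentials

variable {n : ℕ}

lemma pdist_nonneg (s : ℝ) (p q : SpaceTime n) : 0 ≤ pdist s p q :=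
  (norm_nonneg _).trans (le_max_left _ _)

lemma abs_snd_sub_le {s : ℝ} (hs : 0 < s) (p q : SpaceTime n) :
    |p.2 - q.2| ≤ pdist s p q ^ (2 * s) := by
  have h : |p.2 - q.2| ^ (1 / (2 * s)) ≤ pdist s p q := le_max_right _ _
  have := Real.rpow_le_rpow (by positivity) h (show 0 ≤ 2 * s by positivity)
  rwa [← Real.rpow_mul (abs_nonneg _), one_div_mul_cancel (by positivity), Real.rpow_one] at this

lemma pdist_pos {s : ℝ} (hs : 0 < s) {p q : SpaceTime n} (h : p ≠ q) : 0 < pdist s p q := by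
  refine (pdist_nonneg s p q).lt_of_ne' fun h0 => h ?_
  have h1 : ‖p.1 - q.1‖ ≤ pdist s p q := le_max_left _ _
  have h2 := abs_snd_sub_le hs p q
  rw [h0] at h1 h2
  rw [Real.zero_rpow (by positivity)] at h2
  exact Prod.ext (sub_eq_zero.1 (norm_le_zero_iff.1 h1))
    (sub_eq_zero.1 (abs_nonpos_iff.1 h2))

lemma measurable_shiftQuot_apply (β : ℝ) {f : SpaceTime n → ℝ} (hf : Measurable f)
    (y : SpaceTime n) : Measurable (shiftQuot β f y) :=
  (measurable_shiftQuot β hf).comp measurable_prodMk_left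

/-- The total variation of the fractional quotient. -/
def quotMass (β : ℝ) (f : SpaceTime n → ℝ) (p : SpaceTime n) : ℝ≥0∞ :=
  ∫⁻ u, ‖shiftQuot β f p u‖ₑ

lemma measurable_quotMass (β : ℝ) {f : SpaceTime n → ℝ} (hf : Measurable f) :
    Measurable (quotMass β f) :=
  (measurable_shiftQuot β hf).enorm.lintegral_prod_right'

/-- At scale `z` the growth condition turns the integrated weight into `A z ^ (n + 2 s β + α)`,
while the kernel carries `z ^ (-n)` and its fractional quotient `z ^ (-(n + 2 s β))`. The
alternative bounds, with the total mass, use only that the weight is at most `1`; they are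
informative at large scales when `μ` is finite. -/
lemma exists_potential_bounds [Nontrivial (EuclideanSpace ℝ (Fin n))] {s β : ℝ} (hs : 0 < s)
    (hs1 : s ≤ 1) (hβ : 0 < β) (hβ1 : β < 1) (α : ℝ) : ∃ C : ℝ, 0 < C ∧
      ∀ (A : ℝ) (μ : Measure (SpaceTime n)), 0 ≤ A → HasGrowth s (n + 2 * s * β + α) A μ →
      ∀ z : ℝ, 0 < z →
      (∀ p, ∫⁻ q, ‖piece s z (p - q)‖ₑ ∂μ ≤
        min (ENNReal.ofReal (C * A) * ENNReal.ofReal (z ^ (2 * s * β + α)))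
          (ENNReal.ofReal C * μ univ * ENNReal.ofReal (z ^ (-(n : ℝ))))) ∧
      (∀ p, ∫⁻ q, quotMass β (piece s z) (p - q) ∂μ ≤
        min (ENNReal.ofReal (C * A) * ENNReal.ofReal (z ^ α))
          (ENNReal.ofReal C * μ univ * ENNReal.ofReal (z ^ (-((n : ℝ) + 2 * s * β))))) ∧
      ∀ p p', pdist s p p' ≤ z →
        ∫⁻ q, (∫⁻ u, ‖shiftQuot β (piece s z) (p - q) u
            - shiftQuot β (piece s z) (p' - q) u‖ₑ) ∂μ ≤
          ENNReal.ofReal (C * A) * ENNReal.ofReal (z ^ α *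
            (pdist s p p' / z + (pdist s p p' / z) ^ (2 * s))) := by
  obtain ⟨C₁, hC₁, h⟩ := exists_piece_bound (n := n) hs hs1 hβ hβ1
  obtain ⟨C₂, hC₂, hw⟩ := exists_lintegral_weight_dil_le (n := n) hs hs1 hβ
  refine ⟨C₁ * (C₂ + 1), by positivity, fun A μ hA hμ z hz => ?_⟩
  obtain ⟨h0, h1, h2⟩ := h z hz
  set ρ : ℝ := n + 2 * s * β + α
  have hmeas : ∀ p : SpaceTime n, Measurable fun q =>
      ENNReal.ofReal (weight s β (dil s z (p - q))) := fun p =>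
    ((continuous_weight s β).comp ((continuous_dil s z).comp
      (continuous_const.sub continuous_id))).measurable.ennreal_ofReal
  have grow : ∀ (p : SpaceTime n) (e a : ℝ), 0 ≤ a →
      ENNReal.ofReal (C₁ * z ^ (-e) * a) * ∫⁻ q, ENNReal.ofReal (weight s β (dil s z (p - q))) ∂μ ≤
        ENNReal.ofReal (C₁ * (C₂ + 1) * A) * ENNReal.ofReal (z ^ (ρ - e) * a) := by
    intro p e a ha
    refine (mul_le_mul_right (hw μ ρ A hA hμ p z hz) _).trans ?_
    rw [← ENNReal.ofReal_mul (by positivity), ← ENNReal.ofReal_mul (by positivity)]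
    refine ENNReal.ofReal_le_ofReal ?_
    have hzz : z ^ (ρ - e) = z ^ (-e) * z ^ ρ := by rw [← Real.rpow_add hz]; congr 1; ring
    rw [hzz]
    have : 0 ≤ C₁ * A * (z ^ (-e) * z ^ ρ * a) := by positivity
    nlinarith
  have fin : ∀ (p : SpaceTime n) (e : ℝ),
      ENNReal.ofReal (C₁ * z ^ (-e)) * ∫⁻ q, ENNReal.ofReal (weight s β (dil s z (p - q))) ∂μ ≤
        ENNReal.ofReal (C₁ * (C₂ + 1)) * μ univ * ENNReal.ofReal (z ^ (-e)) := by
    intro p e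
    have hle : ∫⁻ q, ENNReal.ofReal (weight s β (dil s z (p - q))) ∂μ ≤ μ univ := by
      refine (lintegral_mono (g := fun _ => 1) fun q => ?_).trans_eq (by simp)
      exact (ENNReal.ofReal_le_ofReal (weight_le_one hs hβ _)).trans_eq ENNReal.ofReal_one
    calc _ ≤ ENNReal.ofReal (C₁ * z ^ (-e)) * μ univ := by gcongr
      _ = ENNReal.ofReal C₁ * μ univ * ENNReal.ofReal (z ^ (-e)) := by
          rw [ENNReal.ofReal_mul hC₁.le]; ring
      _ ≤ _ := by
          gcongr
          nlinarith
  refine ⟨fun p => le_min ?_ ?_, fun p => le_min ?_ ?_, fun p p' hpp => ?_⟩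
  · refine (lintegral_mono fun q => h0 (p - q)).trans ?_
    rw [lintegral_const_mul _ (hmeas p)]
    have := grow p n 1 zero_le_one
    simp only [mul_one, ρ] at this
    rwa [show (n : ℝ) + 2 * s * β + α - n = 2 * s * β + α by ring] at this
  · refine (lintegral_mono fun q => h0 (p - q)).trans ?_
    rw [lintegral_const_mul _ (hmeas p)]
    exact fin p n
  · refine (lintegral_mono fun q => h1 (p - q)).trans ?_
    rw [lintegral_const_mul _ (hmeas p)]
    have := grow p ((n : ℝ) + 2 * s * β) 1 zero_le_one
    simp only [mul_one, ρ] at this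
    rwa [show (n : ℝ) + 2 * s * β + α - (n + 2 * s * β) = α by ring] at this
  · refine (lintegral_mono fun q => h1 (p - q)).trans ?_
    rw [lintegral_const_mul _ (hmeas p)]
    exact fin p _
  · have hz2 : 0 < z ^ (2 * s) := by positivity
    have hd := pdist_nonneg s p p'
    have hx : ‖p.1 - p'.1‖ ≤ pdist s p p' := le_max_left _ _
    have ht := abs_snd_sub_le hs p p'
    have e1 : ∀ q : SpaceTime n, (p - q).1 - (p' - q).1 = p.1 - p'.1 := fun q => by simp
    have e2 : ∀ q : SpaceTime n, (p - q).2 - (p' - q).2 = p.2 - p'.2 := fun q => by simp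
    refine (lintegral_mono fun q => h2 (p - q) (p' - q) ?_ ?_).trans ?_
    · rw [e1]; exact hx.trans hpp
    · rw [e2]; exact ht.trans (Real.rpow_le_rpow hd hpp (by positivity))
    · simp only [e1, e2]
      rw [lintegral_const_mul _ (hmeas p)]
      refine (grow p ((n : ℝ) + 2 * s * β) _ (by positivity)).trans ?_
      rw [show ρ - ((n : ℝ) + 2 * s * β) = α by simp only [ρ]; ring]
      gcongr
      rw [Real.div_rpow hd hz.le]
      gcongr

lemma hasSum_shiftQuot_P {s : ℝ} (β : ℝ) (hs : 0 < s) (hs1 : s ≤ 1) (y : SpaceTime n) (u : ℝ) :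
    HasSum (fun k : ℤ => shiftQuot β (piece s ((2 : ℝ) ^ k)) y u) (shiftQuot β (P s) y u) :=
  ((hasSum_piece hs hs1 _).sub (hasSum_piece hs hs1 y)).div_const _

lemma quotMass_P_le {s : ℝ} (β : ℝ) (hs : 0 < s) (hs1 : s ≤ 1) (y : SpaceTime n) :
    quotMass β (P s) y ≤ ∑' k : ℤ, quotMass β (piece s ((2 : ℝ) ^ k)) y := by
  unfold quotMass
  rw [← lintegral_tsum fun k =>
    (measurable_shiftQuot_apply β (measurable_piece hs _) y).enorm.aemeasurable]
  refine lintegral_mono fun u => ?_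
  rw [← (hasSum_shiftQuot_P β hs hs1 y u).tsum_eq]
  exact enorm_tsum_le_tsum_enorm

/-- Where the dyadic fractional quotients are summable, the fractional derivative of `P_s` is the
sum of those of its pieces. -/
lemma hasSum_timeDeriv_P {s β : ℝ} (hs : 0 < s) (hs1 : s ≤ 1) {y : SpaceTime n}
    (hy : ∑' k : ℤ, quotMass β (piece s ((2 : ℝ) ^ k)) y < ⊤) :
    (∀ k : ℤ, Integrable (shiftQuot β (piece s ((2 : ℝ) ^ k)) y)) ∧
    HasSum (fun k : ℤ => ∫ u, shiftQuot β (piece s ((2 : ℝ) ^ k)) y u) (timeDeriv β (P s) y) := by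
  have hmeas : ∀ k : ℤ, Measurable (shiftQuot β (piece s ((2 : ℝ) ^ k)) y) := fun k =>
    measurable_shiftQuot_apply β (measurable_piece hs _) y
  have hint : ∀ k : ℤ, Integrable (shiftQuot β (piece s ((2 : ℝ) ^ k)) y) := fun k =>
    ⟨(hmeas k).aestronglyMeasurable, (ENNReal.le_tsum k).trans_lt hy⟩
  refine ⟨hint, ?_⟩
  rw [timeDeriv_eq]
  have hsum : Summable fun k : ℤ => ∫ u, ‖shiftQuot β (piece s ((2 : ℝ) ^ k)) y u‖ := by
    refine (ENNReal.summable_toReal hy.ne).congr fun k => ?_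
    exact (integral_norm_eq_lintegral_enorm (hmeas k).aestronglyMeasurable).symm
  have h := hasSum_integral_of_summable_integral_norm hint hsum
  simpa only [(hasSum_shiftQuot_P β hs hs1 y _).tsum_eq] using h

end Potentials

/-! ### Convergence, the Hölder estimate and Fubini. -/

section Main

variable {n : ℕ}

lemma HasGrowth.mono {s ρ A : ℝ} {μ ν : Measure (SpaceTime n)} (h : HasGrowth s ρ A μ)
    (hν : ν ≤ μ) : HasGrowth s ρ A ν :=
  fun p r hr => (hν _).trans (h p r hr)

lemma measurable_const_sub (p : SpaceTime n) : Measurable fun q : SpaceTime n => p - q :=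
  (continuous_const.sub continuous_id).measurable

lemma measurable_comp_const_sub {X : Type*} [MeasurableSpace X] {f : SpaceTime n → X}
    (hf : Measurable f) (p : SpaceTime n) : Measurable fun q => f (p - q) :=
  hf.comp (measurable_const_sub p)

/-- Growth makes the small scales summable, like `z ^ α`, and finiteness of `μ` the large ones, like
`z ^ (-(n + 2 s β))`. -/
lemma lintegral_tsum_quotMass_lt_top [Nontrivial (EuclideanSpace ℝ (Fin n))] {s β α A : ℝ}
    (hs : 0 < s) (hs1 : s ≤ 1) (hβ : 0 < β) (hβ1 : β < 1) (hα : 0 < α)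
    {μ : Measure (SpaceTime n)} [IsFiniteMeasure μ] (hA : 0 ≤ A)
    (hμ : HasGrowth s (n + 2 * s * β + α) A μ) (p : SpaceTime n) :
    ∫⁻ q, ∑' k : ℤ, quotMass β (piece s ((2 : ℝ) ^ k)) (p - q) ∂μ < ⊤ := by
  obtain ⟨C, hC, h⟩ := exists_potential_bounds (n := n) hs hs1 hβ hβ1 α
  rw [lintegral_tsum fun k => (measurable_comp_const_sub
    (measurable_quotMass β (measurable_piece hs _)) p).aemeasurable]
  refine (ENNReal.tsum_le_tsum fun k => (h A μ hA hμ ((2 : ℝ) ^ k) (by positivity)).2.1 p).trans_lt ?_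
  exact tsum_min_zpow_lt_top hα (by positivity) ENNReal.ofReal_ne_top
    (ENNReal.mul_ne_top ENNReal.ofReal_ne_top (measure_ne_top μ _))

/-- Finiteness almost everywhere is a local statement: the restrictions of `μ` to balls are finite
and inherit the growth. Hence the exceptional points, where the kernel may take a default value, are
negligible for every admissible measure. -/
lemma ae_tsum_quotMass_lt_top [Nontrivial (EuclideanSpace ℝ (Fin n))] {s β α A : ℝ}
    (hs : 0 < s) (hs1 : s ≤ 1) (hβ : 0 < β) (hβ1 : β < 1) (hα : 0 < α)
    {μ : Measure (SpaceTime n)} (hA : 0 ≤ A)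
    (hμ : HasGrowth s (n + 2 * s * β + α) A μ) (p : SpaceTime n) :
    ∀ᵐ q ∂μ, ∑' k : ℤ, quotMass β (piece s ((2 : ℝ) ^ k)) (p - q) < ⊤ := by
  have := hμ.isLocallyFiniteMeasure
  have hcover : ⋃ N : ℕ, Metric.closedBall (0 : SpaceTime n) N = univ := Metric.iUnion_closedBall_nat 0
  rw [← Measure.restrict_univ (μ := μ), ← hcover, ae_restrict_iUnion_iff]
  intro N
  have : IsFiniteMeasure (μ.restrict (Metric.closedBall (0 : SpaceTime n) N)) :=
    ⟨by rw [Measure.restrict_apply_univ]; exact (isCompact_closedBall _ _).measure_lt_top⟩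
  refine ae_lt_top ?_ (lintegral_tsum_quotMass_lt_top hs hs1 hβ hβ1 hα hA
    (hμ.mono Measure.restrict_le_self) p).ne
  exact Measurable.tsum fun k =>
    measurable_comp_const_sub (measurable_quotMass β (measurable_piece hs _)) p

/-- The total variation of a difference of fractional quotients. -/
def diffMass (β : ℝ) (f : SpaceTime n → ℝ) (p p' : SpaceTime n) : ℝ≥0∞ :=
  ∫⁻ u, ‖shiftQuot β f p u - shiftQuot β f p' u‖ₑ

lemma measurable_diffMass (β : ℝ) {f : SpaceTime n → ℝ} (hf : Measurable f) (p p' : SpaceTime n) :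
    Measurable fun q => diffMass β f (p - q) (p' - q) := by
  have h : ∀ p : SpaceTime n, Measurable fun x : SpaceTime n × ℝ =>
      shiftQuot β f (p - x.1) x.2 := fun p =>
    (measurable_shiftQuot β hf).comp
      (((measurable_const_sub p).comp measurable_fst).prodMk measurable_snd)
  exact ((h p).sub (h p')).enorm.lintegral_prod_right'

lemma diffMass_le (β : ℝ) {f : SpaceTime n → ℝ} (hf : Measurable f) (p p' : SpaceTime n) :
    diffMass β f p p' ≤ quotMass β f p + quotMass β f p' := by
  unfold quotMass diffMass
  rw [← lintegral_add_left (measurable_shiftQuot_apply β hf p).enorm]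
  exact lintegral_mono fun u => enorm_sub_le

/-- Outside a null set both fractional derivatives are sums over the pieces. Comparing them piece by
piece keeps the cancellation that is needed at large scales. -/
lemma ae_enorm_sub_le_tsum_diffMass [Nontrivial (EuclideanSpace ℝ (Fin n))] {s β α A : ℝ}
    (hs : 0 < s) (hs1 : s ≤ 1) (hβ : 0 < β) (hβ1 : β < 1) (hα : 0 < α)
    {μ : Measure (SpaceTime n)} (hA : 0 ≤ A)
    (hμ : HasGrowth s (n + 2 * s * β + α) A μ) (p p' : SpaceTime n) :
    ∀ᵐ q ∂μ, ‖timeDeriv β (P s) (p - q) - timeDeriv β (P s) (p' - q)‖ₑ ≤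
      ∑' k : ℤ, diffMass β (piece s ((2 : ℝ) ^ k)) (p - q) (p' - q) := by
  filter_upwards [ae_tsum_quotMass_lt_top hs hs1 hβ hβ1 hα hA hμ p,
    ae_tsum_quotMass_lt_top hs hs1 hβ hβ1 hα hA hμ p'] with q hq hq'
  obtain ⟨i1, s1⟩ := hasSum_timeDeriv_P hs hs1 hq
  obtain ⟨i2, s2⟩ := hasSum_timeDeriv_P hs hs1 hq'
  rw [← (s1.sub s2).tsum_eq]
  refine enorm_tsum_le_tsum_enorm.trans (ENNReal.tsum_le_tsum fun k => ?_)
  rw [← integral_sub (i1 k) (i2 k)]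
  exact enorm_integral_le_lintegral_enorm _

/-- At scales below the distance of the two points there is no cancellation, and the difference is
bounded by the sum of the two masses, whence the factor `2` in the hypothesis of
`exists_tsum_dyadic_le`. -/
lemma exists_tsum_lintegral_diffMass_le [Nontrivial (EuclideanSpace ℝ (Fin n))] {s β α : ℝ}
    (hs : 0 < s) (hs1 : s ≤ 1) (hβ : 0 < β) (hβ1 : β < 1) (hα : 0 < α) (hα1 : α < min 1 (2 * s)) :
    ∃ C : ℝ, 0 < C ∧ ∀ (A : ℝ) (μ : Measure (SpaceTime n)), 0 ≤ A →
      HasGrowth s (n + 2 * s * β + α) A μ → ∀ p p' : SpaceTime n, p ≠ p' →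
      ∑' k : ℤ, ∫⁻ q, diffMass β (piece s ((2 : ℝ) ^ k)) (p - q) (p' - q) ∂μ ≤
        ENNReal.ofReal (C * A * pdist s p p' ^ α) := by
  obtain ⟨C, hC, h⟩ := exists_potential_bounds (n := n) hs hs1 hβ hβ1 α
  obtain ⟨S, hS, hsum⟩ := exists_tsum_dyadic_le hα hα1
  refine ⟨C * S, by positivity, fun A μ hA hμ p p' hne => ?_⟩
  have hρ := pdist_pos hs hne
  have hT := hsum (ENNReal.ofReal (C * A))
    (fun k => ∫⁻ q, diffMass β (piece s ((2 : ℝ) ^ k)) (p - q) (p' - q) ∂μ) (pdist s p p') hρ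
    (fun k => ?_) fun k hk => (h A μ hA hμ ((2 : ℝ) ^ k) (by positivity)).2.2 p p' hk
  · refine hT.trans_eq ?_
    rw [← ENNReal.ofReal_mul (by positivity)]
    congr 1
    ring
  · have hb := (h A μ hA hμ ((2 : ℝ) ^ k) (by positivity)).2.1
    have hm := measurable_piece (n := n) hs ((2 : ℝ) ^ k)
    calc _ ≤ ∫⁻ q, (quotMass β (piece s ((2 : ℝ) ^ k)) (p - q)
          + quotMass β (piece s ((2 : ℝ) ^ k)) (p' - q)) ∂μ :=
        lintegral_mono fun q => diffMass_le β hm _ _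
      _ = (∫⁻ q, quotMass β (piece s ((2 : ℝ) ^ k)) (p - q) ∂μ)
          + ∫⁻ q, quotMass β (piece s ((2 : ℝ) ^ k)) (p' - q) ∂μ :=
        lintegral_add_left (measurable_comp_const_sub (measurable_quotMass β hm) p) _
      _ ≤ ENNReal.ofReal (C * A) * ENNReal.ofReal (((2 : ℝ) ^ k) ^ α)
          + ENNReal.ofReal (C * A) * ENNReal.ofReal (((2 : ℝ) ^ k) ^ α) :=
        add_le_add ((hb p).trans (min_le_left _ _)) ((hb p').trans (min_le_left _ _))
      _ = _ := by
        rw [← mul_add, ← ENNReal.ofReal_add (by positivity) (by positivity), two_mul]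

/-- The Hölder estimate for the potential, wherever it is defined. -/
theorem exists_lipSeminorm_le [Nontrivial (EuclideanSpace ℝ (Fin n))] {s β α : ℝ}
    (hs : 0 < s) (hs1 : s ≤ 1) (hβ : 0 < β) (hβ1 : β < 1) (hα : 0 < α) (hα1 : α < min 1 (2 * s)) :
    ∃ C : ℝ, 0 < C ∧ ∀ (A : ℝ) (μ : Measure (SpaceTime n)), 0 ≤ A →
      HasGrowth s (n + 2 * s * β + α) A μ → ConvConverges (timeDeriv β (P s)) μ →
      lipSeminorm s α (conv (timeDeriv β (P s)) μ) ≤ ENNReal.ofReal (C * A) := by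
  obtain ⟨C, hC, h⟩ := exists_tsum_lintegral_diffMass_le (n := n) hs hs1 hβ hβ1 hα hα1
  refine ⟨C, hC, fun A μ hA hμ hconv => iSup₂_le fun p p' => ?_⟩
  rcases eq_or_ne p p' with rfl | hne
  · simp
  have hρ := pdist_pos hs hne
  have hfinal : ‖conv (timeDeriv β (P s)) μ p - conv (timeDeriv β (P s)) μ p'‖ₑ ≤
      ENNReal.ofReal (C * A * pdist s p p' ^ α) := by
    unfold conv
    rw [← integral_sub (hconv p) (hconv p')]
    refine (enorm_integral_le_lintegral_enorm _).trans ((lintegral_mono_ae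
      (ae_enorm_sub_le_tsum_diffMass hs hs1 hβ hβ1 hα hA hμ p p')).trans ?_)
    rw [lintegral_tsum fun k => (measurable_diffMass β (measurable_piece hs _) p p').aemeasurable]
    exact h A μ hA hμ p p' hne
  rw [Real.enorm_eq_ofReal_abs, ENNReal.ofReal_le_ofReal_iff (by positivity)] at hfinal
  exact ENNReal.ofReal_le_ofReal ((div_le_iff₀ (by positivity)).2 hfinal)

/-- The dyadic bounds are of order `z ^ (2 s β + α)` from growth and `z ^ (-n)` from finiteness; `1
≤ n` makes the large scales summable. -/
lemma integrable_P_sub [Nontrivial (EuclideanSpace ℝ (Fin n))] (hn : 1 ≤ n) {s β α A : ℝ}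
    (hs : 0 < s) (hs1 : s ≤ 1) (hβ : 0 < β) (hβ1 : β < 1) (hα : 0 < α)
    {μ : Measure (SpaceTime n)} [IsFiniteMeasure μ] (hA : 0 ≤ A)
    (hμ : HasGrowth s (n + 2 * s * β + α) A μ) : ConvConverges (P s) μ := by
  intro p
  obtain ⟨C, hC, h⟩ := exists_potential_bounds (n := n) hs hs1 hβ hβ1 α
  refine ⟨((measurable_P hs).comp (measurable_const_sub p)).aestronglyMeasurable, ?_⟩
  refine lt_of_le_of_lt (lintegral_mono fun q => ?_)
    (b := ∫⁻ q, ∑' k : ℤ, ‖piece s ((2 : ℝ) ^ k) (p - q)‖ₑ ∂μ) ?_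
  · change ‖P s (p - q)‖ₑ ≤ _
    rw [← (hasSum_piece hs hs1 (p - q)).tsum_eq]
    exact enorm_tsum_le_tsum_enorm
  rw [lintegral_tsum fun k =>
    (measurable_comp_const_sub (measurable_piece hs _) p).enorm.aemeasurable]
  refine (ENNReal.tsum_le_tsum fun k => (h A μ hA hμ ((2 : ℝ) ^ k) (by positivity)).1 p).trans_lt ?_
  exact tsum_min_zpow_lt_top (by positivity) (by exact_mod_cast hn) ENNReal.ofReal_ne_top
    (ENNReal.mul_ne_top ENNReal.ofReal_ne_top (measure_ne_top μ _))

lemma integrable_shiftQuot_prod [Nontrivial (EuclideanSpace ℝ (Fin n))] {s β α A : ℝ}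
    (hs : 0 < s) (hs1 : s ≤ 1) (hβ : 0 < β) (hβ1 : β < 1) (hα : 0 < α)
    {μ : Measure (SpaceTime n)} [IsFiniteMeasure μ] (hA : 0 ≤ A)
    (hμ : HasGrowth s (n + 2 * s * β + α) A μ) (p : SpaceTime n) :
    Integrable (Function.uncurry fun (q : SpaceTime n) u => shiftQuot β (P s) (p - q) u)
      (μ.prod volume) := by
  have hm : Measurable (Function.uncurry fun (q : SpaceTime n) u => shiftQuot β (P s) (p - q) u) :=
    (measurable_shiftQuot β (measurable_P hs)).comp
      (((measurable_const_sub p).comp measurable_fst).prodMk measurable_snd)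
  refine ⟨hm.aestronglyMeasurable, ?_⟩
  unfold HasFiniteIntegral
  rw [lintegral_prod _ hm.enorm.aemeasurable]
  exact (lintegral_mono fun q => quotMass_P_le β hs hs1 (p - q)).trans_lt
    (lintegral_tsum_quotMass_lt_top hs hs1 hβ hβ1 hα hA hμ p)

lemma integral_shiftQuot_sub {β : ℝ} {f : SpaceTime n → ℝ} {μ : Measure (SpaceTime n)}
    (hf : ConvConverges f μ) (p : SpaceTime n) (u : ℝ) :
    ∫ q, shiftQuot β f (p - q) u ∂μ = shiftQuot β (conv f μ) p u := by
  have e : ∀ q : SpaceTime n, ((p - q).1, (p - q).2 + u) = (p.1, p.2 + u) - q := fun q =>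
    Prod.ext rfl (sub_add_eq_add_sub _ _ _)
  simp only [shiftQuot, conv, e]
  rw [integral_div, integral_sub (hf _) (hf p)]

end Main

end FracCaloric

end

theorem mainTheorem10 (n : ℕ) (hn : 1 ≤ n) (s β α : ℝ)
    (hs : 0 < s) (hs1 : s ≤ 1) (hβ : 0 < β) (hβ1 : β < 1)
    (hα : 0 < α) (hα1 : α < min 1 (2 * s)) (hsum : 2 * s * β + α < 2) :
    ∃ C : ℝ, 0 < C ∧
      ∀ (A : ℝ) (μ : Measure (SpaceTime n)), 0 ≤ A →
        FracCaloric.HasGrowth s (n + 2 * s * β + α) A μ →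
        -- the estimate, whenever the potential is defined
        (FracCaloric.ConvConverges (FracCaloric.timeDeriv β (FracCaloric.P s)) μ →
          FracCaloric.lipSeminorm s α
              (FracCaloric.conv (FracCaloric.timeDeriv β (FracCaloric.P s)) μ)
            ≤ ENNReal.ofReal (C * A)) ∧
        -- for finite measures it is defined, in both ways of reading it, and they agree
        (IsFiniteMeasure μ →
          FracCaloric.ConvConverges (FracCaloric.timeDeriv β (FracCaloric.P s)) μ ∧
          FracCaloric.ConvConverges (FracCaloric.P s) μ ∧
          (∀ p : SpaceTime n, Integrable
            (FracCaloric.timeQuotient β (FracCaloric.conv (FracCaloric.P s) μ) p)) ∧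
          FracCaloric.timeDeriv β (FracCaloric.conv (FracCaloric.P s) μ)
            = FracCaloric.conv (FracCaloric.timeDeriv β (FracCaloric.P s)) μ) := by
  -- From this instance the nontriviality of the spatial factor is inferred.
  have : Nonempty (Fin n) := ⟨⟨0, hn⟩⟩
  obtain ⟨C, hC, hlip⟩ := FracCaloric.exists_lipSeminorm_le (n := n) hs hs1 hβ hβ1 hα hα1
  refine ⟨C, hC, fun A μ hA hμ => ⟨hlip A μ hA hμ, fun hfin => ?_⟩⟩
  have hP := FracCaloric.integrable_P_sub hn hs hs1 hβ hβ1 hα hA hμ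
  have hprod := FracCaloric.integrable_shiftQuot_prod hs hs1 hβ hβ1 hα hA hμ
  refine ⟨fun p => ?_, hP, fun p => ?_, funext fun p => ?_⟩
  · simp only [FracCaloric.timeDeriv_eq]
    exact (hprod p).integral_prod_left
  -- Integrating out `q` first turns the joint integrand into the fractional quotient of `P_s ∗ μ`,
  -- by linearity; a translation in time passes from the increment `u` to `τ`.
  · have h := (hprod p).integral_prod_right
    simp only [Function.uncurry, FracCaloric.integral_shiftQuot_sub hP] at h
    exact (h.comp_sub_right p.2).congr
      (.of_forall fun τ => (FracCaloric.timeQuotient_eq β _ p τ).symm)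
  -- Fubini: the two orders of integration are the two readings of the fractional derivative of the
  -- potential.
  · have h := integral_integral_swap (hprod p)
    simp only [FracCaloric.integral_shiftQuot_sub hP] at h
    rw [FracCaloric.timeDeriv_eq, ← h]
    simp only [FracCaloric.conv, FracCaloric.timeDeriv_eq]
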